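/- Let $V$ be a finite set and $n=|V|$. A graph on $V$ is a directed graph $\mathcal G=(V,E)$ whose edge set $E=E(\mathcal G)$ contains all self-loops $i\to i$. It is a \emph{simple DAG} if it contains at most one of $i\to j$, $j\to i$ for all distinct $i,j\in V$ and has no directed cycle of length greater than one. Self-loops are ignored in the sets of parents $\mathrm{pa}(i)$, children $\mathrm{ch}(i)$ and neighbors $\mathrm{ne}(i)=\mathrm{pa}(i)\cup\mathrm{ch}(i)$. The \emph{graphical continuous Lyapunov model} (GCLM) of $\mathcal G$, with uncorrelated noise $C=2I_n$, is the set $\mathcal M_{\mathcal G}$ of all positive definite real matrices $\Sigma$, with rows and columns indexed by $V$, for which there is a real matrix $M$ with all (complex) eigenvalues of strictly negative real part, with $m_{ji}=0$ whenever $i\to j\notin E$, and with $M\Sigma+\Sigma M^T+2I_n=0$. Such a $\Sigma$ represents the normal distribution $\mathcal N(0,\Sigma)$. For $i,j,k\in V$ we write $k\perp\!\!\!\perp\{i,j\}$ if $X_k$ is independent of $(X_i,X_j)$ for $X\sim\mathcal N(0,\Sigma)$ and every $\Sigma\in\mathcal M_{\mathcal G}$. An edge $i\to j$ of a simple DAG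 $\mathcal G$ is \emph{super-covered} if (1) $\mathrm{ch}(i)=\mathrm{ch}(j)\cup\{j\}$ and $\mathrm{pa}(i)\cup\{i\}=\mathrm{pa}(j)$; (2) $k\to l\in E$ for all $k\in\mathrm{pa}(j)$ and $l\in\mathrm{ch}(i)$; and (3) every $k\in V\setminus\{i,j\}$ satisfies $k\in\mathrm{ne}(i)\cap\mathrm{ne}(j)$ or $k\perp\!\!\!\perp\{i,j\}$. A \emph{super-covered edge flip} replaces a super-covered edge $i\to j$ by $j\to i$. \textbf{Theorem.} Let $\mathcal G_1$ and $\mathcal G_2$ be simple DAGs on $V$. Then $\mathcal M_{\mathcal G_1}=\mathcal M_{\mathcal G_2}$ if and only if there is a (finite, possibly empty) sequence of super-covered edge flips, each applied to a simple DAG, that transforms $\mathcal G_1$ into $\mathcal G_2$. Moreover, if $\mathcal M_{\mathcal G_1}=\mathcal M_{\mathcal G_2}$, then $\mathcal G_1$ and $\mathcal G_2$ have the same skeleton (the same edges up to orientation), and $\mathcal G_1$ can be transformed into $\mathcal G_2$ by a sequence of exactly $\delta=|E(\mathcal G_1)\setminus E(\mathcal G_2)|$ super-covered edge flips. -/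

import Mathlib

open MeasureTheory ProbabilityTheory

namespace LyapunovModel

/-! ### Directed graphs

Graphs are Mathlib's `Digraph`s; `G.Adj i j` is the edge `i → j`. Every graph of interest carries
all self-loops, which belong to the edge set but are ignored by parents, children and cycles. -/

section Graph

variable {V : Type*}

/-- The edge set, self-loops included. -/
def edgeSet (G : Digraph V) : Set (V × V) := {e | G.Adj e.1 e.2}

/-- A simple DAG: every vertex has its self-loop, two distinct vertices are joined by at most one
edge, and there is no directed cycle of length greater than one. -/
structure IsSimpleDAG (G : Digraph V) : Prop where
  loops : ∀ i, G.Adj i i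
  simple : ∀ i j, i ≠ j → ¬ (G.Adj i j ∧ G.Adj j i)
  acyclic : ∀ i, ¬ Relation.TransGen (fun a b => a ≠ b ∧ G.Adj a b) i i

/-- Parents of `i`, the vertex `i` itself excluded. -/
def parents (G : Digraph V) (i : V) : Set V := {k | k ≠ i ∧ G.Adj k i}

/-- Children of `i`, the vertex `i` itself excluded. -/
def children (G : Digraph V) (i : V) : Set V := {k | k ≠ i ∧ G.Adj i k}

/-- Neighbors of `i`. -/
def neighbors (G : Digraph V) (i : V) : Set V := parents G i ∪ children G i

/-- Two graphs have the same skeleton: the same edges up to orientation. -/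
def SameSkeleton (G₁ G₂ : Digraph V) : Prop :=
  ∀ i j, (G₁.Adj i j ∨ G₁.Adj j i) ↔ (G₂.Adj i j ∨ G₂.Adj j i)

/-- The graph obtained by replacing the edge `i → j` by `j → i`. -/
def flipEdge (G : Digraph V) (i j : V) : Digraph V where
  Adj a b := (a = j ∧ b = i) ∨ (G.Adj a b ∧ ¬ (a = i ∧ b = j))

end Graph

/-! ### Graphical continuous Lyapunov models -/

section Model

variable {V : Type*} [Fintype V] [DecidableEq V]

/-- A real square matrix is stable if all its complex eigenvalues have negative real part. -/
def IsStable (M : Matrix V V ℝ) : Prop :=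
  ∀ z ∈ spectrum ℂ (M.map (algebraMap ℝ ℂ)), z.re < 0

/-- The graphical continuous Lyapunov model of `G` with volatility matrix `C`, as a set of
covariance matrices. The drift entry `M j i` belongs to the edge `i → j`. -/
def gclmWith (G : Digraph V) (C : Matrix V V ℝ) : Set (Matrix V V ℝ) :=
  {S | S.PosDef ∧ ∃ M : Matrix V V ℝ, (∀ i j, ¬ G.Adj i j → M j i = 0) ∧ IsStable M ∧
    M * S + S * M.transpose + C = 0}

/-- The graphical continuous Lyapunov model with `C = 2 I`. -/
def gclm (G : Digraph V) : Set (Matrix V V ℝ) :=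
  gclmWith G ((2 : ℝ) • (1 : Matrix V V ℝ))

/-- Marginal independence `k ⫫ {i, j}` in the model of `G`: under each centered normal
distribution of the model, the coordinate `X k` is independent of `(X i, X j)`. -/
def MarginallyIndep (G : Digraph V) (k i j : V) : Prop :=
  ∀ S ∈ gclm G, IndepFun (fun x : EuclideanSpace ℝ V => x k)
    (fun x : EuclideanSpace ℝ V => (x i, x j)) (multivariateGaussian 0 S)

/-! ### Super-covered edges -/

/-- The edge `i → j` of `G` is super-covered. -/
structure IsSuperCovered (G : Digraph V) (i j : V) : Prop where
  edge : G.Adj i j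
  children_eq : children G i = children G j ∪ {j}
  parents_eq : parents G i ∪ {i} = parents G j
  parents_children : ∀ k ∈ parents G j, ∀ l ∈ children G i, G.Adj k l
  others : ∀ k, k ≠ i → k ≠ j →
    k ∈ neighbors G i ∩ neighbors G j ∨ MarginallyIndep G k i j

/-- `H` arises from the simple DAG `G` by flipping one super-covered edge. -/
def SuperCoveredFlip (G H : Digraph V) : Prop :=
  IsSimpleDAG G ∧ ∃ i j, IsSuperCovered G i j ∧ H = flipEdge G i j

/-- A sequence of exactly `n` super-covered edge flips transforms `G` into `H`. -/
def FlipSequence (n : ℕ) (G H : Digraph V) : Prop :=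
  ∃ f : ℕ → Digraph V, f 0 = G ∧ f n = H ∧ ∀ t < n, SuperCoveredFlip (f t) (f (t + 1))

end Model

end LyapunovModel

/-! For positive definite `S`, pairing the Lyapunov equation with a row vector `x` gives `x M S xᵀ =
-|x|²`. Hence stability of `M` is automatic (`LyapunovEq.isStable`), and membership in a model is a
linear problem in `M`: two drifts for the same `S` differ by some `N` with `N S` skew-symmetric.

Flips preserve the model. In a DAG, disjoint parent-closed vertex sets are uncorrelated
(`cov_eq_zero_of_parentClosed`), so the independence condition on a super-covered edge `i → j`
becomes purely combinatorial (`IsClosedCover`). Let `w`, `x` be the residuals of `i`, `j` after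
regression on the parents of `i`. The skew combination of `w`, `x` and their covariance vectors
yields an `N` that cancels the drift entry of `i → j` and is otherwise supported on edges of the
flipped graph (`mem_gclm_of_reverse`). The flipped edge is again a closed cover, which gives
equality.

Conversely, explicit covariance matrices on two to four vertices, extended by the identity
(`pad_mem_gclm`), show that the model determines the skeleton and the orientation of unshielded
two-edge paths (`adj_of_unshielded`), and rule out four configurations around a reversed edge. If
two models agree but the graphs differ, take the earliest head `j` of a reversed edge and the latest
tail `i` of a reversed edge into `j`: every way for `i → j` to fail being a closed cover is now
excluded (`exists_isClosedCover_of_gclm_eq`). Flipping it removes exactly one element of the edge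
difference, so induction uses exactly `δ` flips. -/

namespace LyapunovModel

open Matrix

set_option linter.unusedSectionVars false

/-! ### Lyapunov equation, residuals, and reversal of one edge -/

section Lyapunov

variable {V : Type*} [Fintype V] [DecidableEq V]

/-- The Lyapunov equation `M S + S Mᵀ + 2 I = 0`. -/
def LyapunovEq (M S : Matrix V V ℝ) : Prop :=
  M * S + S * M.transpose + (2 : ℝ) • (1 : Matrix V V ℝ) = 0

/-- The drift matrix `M` only uses edges of `G`. -/
def SupportedOn (G : Digraph V) (M : Matrix V V ℝ) : Prop :=
  ∀ i j, ¬ G.Adj i j → M j i = 0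

lemma posDef_symm {S : Matrix V V ℝ} (hS : S.PosDef) : S.transpose = S := by
  simpa [Matrix.IsHermitian] using hS.isHermitian

lemma posDef_comm {S : Matrix V V ℝ} (hS : S.PosDef) (a b : V) : S a b = S b a :=
  congrFun (congrFun (posDef_symm hS) b) a

lemma vecMul_dotProduct_pos {S : Matrix V V ℝ} (hS : S.PosDef) {x : V → ℝ} (hx : x ≠ 0) :
    0 < (x ᵥ* S) ⬝ᵥ x := by
  have := hS.dotProduct_mulVec_pos hx
  rwa [star_trivial, dotProduct_mulVec] at this

lemma vecMul_dotProduct_nonneg {S : Matrix V V ℝ} (hS : S.PosDef) (x : V → ℝ) :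
    0 ≤ (x ᵥ* S) ⬝ᵥ x := by
  rcases eq_or_ne x 0 with rfl | hx
  · simp
  · exact (vecMul_dotProduct_pos hS hx).le

lemma vecMul_dotProduct_comm {S : Matrix V V ℝ} (hS : S.PosDef) (x y : V → ℝ) :
    (x ᵥ* S) ⬝ᵥ y = (y ᵥ* S) ⬝ᵥ x := by
  rw [← dotProduct_mulVec, dotProduct_comm, ← vecMul_transpose, posDef_symm hS]

/-- The two products in the equation are transposes of each other, so they contribute equally to the
quadratic form. -/
lemma LyapunovEq.quadratic {M S : Matrix V V ℝ} (hS : S.PosDef) (h : LyapunovEq M S)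
    (x : V → ℝ) : ((x ᵥ* M) ᵥ* S) ⬝ᵥ x = - (x ⬝ᵥ x) := by
  have h1 := congrArg (fun A => (x ᵥ* A) ⬝ᵥ x) h
  simp only [vecMul_add, vecMul_smul, vecMul_one, add_dotProduct, smul_dotProduct, vecMul_zero,
    zero_dotProduct, smul_eq_mul, ← vecMul_vecMul] at h1
  have h2 : ((x ᵥ* S) ᵥ* Mᵀ) ⬝ᵥ x = ((x ᵥ* M) ᵥ* S) ⬝ᵥ x := by
    rw [vecMul_transpose, dotProduct_comm, dotProduct_mulVec, vecMul_dotProduct_comm hS,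
      dotProduct_comm]
  linarith

/-- For a left eigenvector `a + i b` with eigenvalue `z`, adding the quadratic identities for `a`
and `b` cancels the terms in `z.im` and leaves `z.re` times a nonnegative number equal to `-(|a|² +
|b|²) < 0`. -/
lemma LyapunovEq.isStable {M S : Matrix V V ℝ} (hS : S.PosDef) (h : LyapunovEq M S) :
    IsStable M := by
  intro z hz
  rw [spectrum.mem_iff, Matrix.isUnit_iff_isUnit_det, isUnit_iff_ne_zero, not_not,
    ← Matrix.exists_vecMul_eq_zero_iff] at hz
  obtain ⟨y, hy0, hy⟩ := hz
  have hy' : ∀ v, ∑ u, y u * (M u v : ℂ) = z * y v := by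
    intro v
    have := congrFun hy v
    rw [vecMul_sub, Pi.sub_apply, Pi.zero_apply, sub_eq_zero, Algebra.algebraMap_eq_smul_one,
      vecMul_smul, vecMul_one] at this
    simpa [vecMul, dotProduct] using this.symm
  set a : V → ℝ := fun v => (y v).re with ha
  set b : V → ℝ := fun v => (y v).im with hb
  have hA : a ᵥ* M = z.re • a - z.im • b := by
    ext v
    have := congrArg Complex.re (hy' v)
    simpa [vecMul, dotProduct, a, b] using this
  have hB : b ᵥ* M = z.re • b + z.im • a := by
    ext v
    have := congrArg Complex.im (hy' v)
    simpa [vecMul, dotProduct, a, b] using this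
  have qa := h.quadratic hS a
  have qb := h.quadratic hS b
  rw [hA] at qa
  rw [hB] at qb
  simp only [sub_vecMul, add_vecMul, smul_vecMul, sub_dotProduct, add_dotProduct, smul_dotProduct,
    smul_eq_mul] at qa qb
  have hc := vecMul_dotProduct_comm hS a b
  have na := vecMul_dotProduct_nonneg hS a
  have nb := vecMul_dotProduct_nonneg hS b
  have sa : 0 ≤ a ⬝ᵥ a := Finset.sum_nonneg fun i _ => mul_self_nonneg _
  have sb : 0 ≤ b ⬝ᵥ b := Finset.sum_nonneg fun i _ => mul_self_nonneg _
  have hab : 0 < a ⬝ᵥ a + b ⬝ᵥ b := by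
    by_contra hcon
    have ea : a = 0 := dotProduct_self_eq_zero.1 (by linarith)
    have eb : b = 0 := dotProduct_self_eq_zero.1 (by linarith)
    exact hy0 (funext fun v => Complex.ext (congrFun ea v) (congrFun eb v))
  have key : z.re * ((a ᵥ* S) ⬝ᵥ a + (b ᵥ* S) ⬝ᵥ b) = -(a ⬝ᵥ a + b ⬝ᵥ b) := by
    rw [hc] at qb; linarith
  by_contra hz
  have := mul_nonneg (not_lt.1 hz) (add_nonneg na nb)
  linarith

lemma mem_gclm_iff {G : Digraph V} {S : Matrix V V ℝ} :
    S ∈ gclm G ↔ S.PosDef ∧ ∃ M, SupportedOn G M ∧ LyapunovEq M S :=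
  ⟨fun ⟨h, M, h1, _, h3⟩ => ⟨h, M, h1, h3⟩, fun ⟨h, M, h1, h3⟩ =>
    ⟨h, M, h1, LyapunovEq.isStable h h3, h3⟩⟩

/-- Regression coefficients: row combinations over `P` can be prescribed on `P`. -/
lemma exists_vecMul_eq_on {S : Matrix V V ℝ} (hS : S.PosDef) (P : Set V) (b : V → ℝ) :
    ∃ β : V → ℝ, (∀ v ∉ P, β v = 0) ∧ ∀ p ∈ P, (β ᵥ* S) p = b p := by
  classical
  set T := S.submatrix (Subtype.val : P → V) Subtype.val with hT
  have hTp : T.PosDef := hS.submatrix Subtype.val_injective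
  have hu : IsUnit T.det := (Matrix.isUnit_iff_isUnit_det _).1 hTp.isUnit
  set γ : P → ℝ := (fun p : P => b p) ᵥ* T⁻¹ with hγ
  refine ⟨fun v => if h : v ∈ P then γ ⟨v, h⟩ else 0, fun v hv => by simp [hv], fun p hp => ?_⟩
  have h1 : (γ ᵥ* T) ⟨p, hp⟩ = b p := by
    rw [hγ, vecMul_vecMul, Matrix.nonsing_inv_mul _ hu, vecMul_one]
  rw [← h1]
  simp only [vecMul, dotProduct, hT, submatrix_apply]
  rw [← Fintype.sum_subtype_add_sum_subtype (fun v => v ∈ P)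
    fun v => (if h : v ∈ P then γ ⟨v, h⟩ else 0) * S v p]
  rw [Finset.sum_eq_zero (s := (Finset.univ : Finset {v // v ∉ P})), add_zero]
  · exact Finset.sum_congr rfl fun v _ => by simp [v.2]
  · intro v _
    simp [v.2]

/-- The residual of `v` after regression on `P`. -/
lemma exists_residual {S : Matrix V V ℝ} (hS : S.PosDef) (P : Set V) {v : V} (hv : v ∉ P) :
    ∃ w : V → ℝ, w v = 1 ∧ (∀ u ∉ P, u ≠ v → w u = 0) ∧ (∀ p ∈ P, (w ᵥ* S) p = 0) ∧
      0 < (w ᵥ* S) v := by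
  obtain ⟨β, hβ, hβ'⟩ := exists_vecMul_eq_on hS P (S v)
  refine ⟨Pi.single v 1 - β, by simp [hβ v hv], fun u hu huv => by simp [hβ u hu, huv],
    fun p hp => ?_, ?_⟩
  · simp [sub_vecMul, hβ' p hp]
  · set w := Pi.single v 1 - β with hw
    -- The residual variance is the single product at `v`: `w ᵥ* S` vanishes on `P`, and `w`
    -- vanishes off `P ∪ {v}`.
    have hwv : w v = 1 := by simp [hw, hβ v hv]
    have hpos := vecMul_dotProduct_pos hS (x := w) (fun h => by simp [h] at hwv)
    rw [dotProduct, Finset.sum_eq_single v, hwv, mul_one] at hpos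
    · exact hpos
    · intro u _ huv
      by_cases hu : u ∈ P
      · simp [hw, sub_vecMul, hβ' u hu]
      · simp [hw, hβ u hu, huv]
    · simp

/-- The strict edge relation. -/
abbrev StrictAdj (G : Digraph V) (a b : V) : Prop := a ≠ b ∧ G.Adj a b

lemma IsSimpleDAG.wellFounded {G : Digraph V} (hG : IsSimpleDAG G) :
    WellFounded (Relation.TransGen (StrictAdj G)) := by
  have : IsTrans V (Relation.TransGen (StrictAdj G)) := ⟨fun _ _ _ => Relation.TransGen.trans⟩
  have : Std.Irrefl (Relation.TransGen (StrictAdj G)) := ⟨hG.acyclic⟩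
  exact Finite.wellFounded_of_trans_of_irrefl _

/-- Let `w` be the residual of `v` after regression on its strict ancestors. Then `w ᵥ* S` vanishes
on the ancestors and `w ᵥ* M` vanishes off ancestors and `v`, so the quadratic identity at `w`
reduces to `M v v` times the residual variance being negative. -/
lemma LyapunovEq.diag_neg {G : Digraph V} (hG : IsSimpleDAG G) {M S : Matrix V V ℝ}
    (hS : S.PosDef) (hM : SupportedOn G M) (h : LyapunovEq M S) (v : V) : M v v < 0 := by
  set P : Set V := {a | Relation.TransGen (StrictAdj G) a v} with hP
  have hvP : v ∉ P := hG.acyclic v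
  obtain ⟨w, hw1, hw0, hwP, hwv⟩ := exists_residual hS P hvP
  have hq := h.quadratic hS w
  have hw : w ≠ 0 := fun hw => by simp [hw] at hw1
  have hpos : 0 < w ⬝ᵥ w :=
    lt_of_le_of_ne (Finset.sum_nonneg fun i _ => mul_self_nonneg _)
      fun h0 => hw (dotProduct_self_eq_zero.1 h0.symm)
  have hout : ∀ u ∉ P, u ≠ v → (w ᵥ* M) u = 0 := by
    intro u hu huv
    refine Finset.sum_eq_zero fun a _ => ?_
    by_cases ha : a ∈ P ∨ a = v
    · have : ¬ G.Adj u a := by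
        intro hadj
        rcases ha with ha | rfl
        · refine hu (Relation.TransGen.head ⟨?_, hadj⟩ ha)
          rintro rfl; exact hu ha
        · exact hu (Relation.TransGen.single ⟨huv, hadj⟩)
      simp [hM _ _ this]
    · push Not at ha
      simp [hw0 a ha.1 ha.2]
  have hin : (w ᵥ* M) v = M v v := by
    rw [vecMul, dotProduct, Finset.sum_eq_single v, hw1, one_mul]
    · intro a _ hav
      by_cases ha : a ∈ P
      · have : ¬ G.Adj v a := fun hadj =>
          hG.acyclic v (Relation.TransGen.head ⟨hav.symm, hadj⟩ ha)
        rw [hM _ _ this, mul_zero]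
      · rw [hw0 a ha hav, zero_mul]
    · simp
  rw [vecMul_dotProduct_comm hS, dotProduct, Finset.sum_eq_single v, hin] at hq
  · by_contra hc
    have := mul_nonneg hwv.le (not_lt.1 hc)
    linarith
  · intro u _ huv
    by_cases hu : u ∈ P
    · rw [hwP u hu, zero_mul]
    · rw [hout u hu huv, mul_zero]
  · simp

/-- Two disjoint parent-closed sets of vertices are uncorrelated. -/
lemma cov_eq_zero_of_parentClosed {G : Digraph V} (hG : IsSimpleDAG G) {S : Matrix V V ℝ}
    (hS : S ∈ gclm G) {Q R : Set V} (hQ : ∀ a b, b ∈ Q → G.Adj a b → a ∈ Q)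
    (hR : ∀ a b, b ∈ R → G.Adj a b → a ∈ R) (hQR : Disjoint Q R) {q r : V} (hq : q ∈ Q)
    (hr : r ∈ R) : S q r = 0 := by
  obtain ⟨hpd, M, hM, hL⟩ := mem_gclm_iff.1 hS
  -- Nested induction along ancestors: off-diagonal terms of the entry `(q, r)` vanish by induction,
  -- leaving `(M q q + M r r) * S q r = 0` with a negative first factor.
  induction q using hG.wellFounded.induction generalizing r with
  | _ q ihq =>
  induction r using hG.wellFounded.induction with
  | _ r ihr =>
  have hne : q ≠ r := fun h => Set.disjoint_left.1 hQR hq (h ▸ hr)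
  have h := congrFun (congrFun hL q) r
  simp only [Matrix.add_apply, Matrix.mul_apply, Matrix.smul_apply, transpose_apply,
    one_apply_ne hne, smul_zero, add_zero, Matrix.zero_apply] at h
  rw [Finset.sum_eq_single q, Finset.sum_eq_single r] at h
  · have h1 := hL.diag_neg hG hpd hM q
    have h2 := hL.diag_neg hG hpd hM r
    have : (M q q + M r r) * S q r = 0 := by linarith
    rcases mul_eq_zero.1 this with h | h
    · linarith
    · exact h
  · intro b _ hb
    by_cases hadj : G.Adj b r
    · rw [ihr b (Relation.TransGen.single ⟨hb, hadj⟩) (hR _ _ hr hadj), zero_mul]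
    · rw [hM _ _ hadj, mul_zero]
  · simp
  · intro a _ ha
    by_cases hadj : G.Adj a q
    · rw [ihq a (Relation.TransGen.single ⟨ha, hadj⟩) (hQ _ _ hq hadj) hr, mul_zero]
    · rw [hM _ _ hadj, zero_mul]
  · simp

/-- Reversing an edge whose endpoints share all parents and children, when parents and
endpoints are joined to all children and uncorrelated with everything else. -/
lemma mem_gclm_of_reverse {G H : Digraph V} {i j : V} (hij : i ≠ j) {P C : Set V} (hiP : i ∉ P)
    (hjP : j ∉ P)
    (hGH : ∀ a b, G.Adj a b → ¬ (a = i ∧ b = j) → H.Adj a b)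
    (hH : ∀ a b, (a ∈ P ∨ a = i ∨ a = j) → (b ∈ C ∨ b = i ∨ b = j) → ¬ (a = i ∧ b = j) →
      H.Adj a b)
    {S : Matrix V V ℝ} (hS : S ∈ gclm G)
    (h0 : ∀ q r, (q ∈ P ∨ q = i ∨ q = j) → r ∉ P → r ∉ C → r ≠ i → r ≠ j → S q r = 0) :
    S ∈ gclm H := by
  obtain ⟨hpd, M, hM, hL⟩ := mem_gclm_iff.1 hS
  obtain ⟨w, hw1, hw0, hwP, hwv⟩ := exists_residual hpd P hiP
  obtain ⟨x, hx1, hx0, hxP, hxv⟩ := exists_residual hpd P hjP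
  have hws : ∀ b, ¬ (b ∈ P ∨ b = i ∨ b = j) → w b = 0 := fun b hb => by
    push Not at hb; exact hw0 b hb.1 hb.2.1
  have hxs : ∀ b, ¬ (b ∈ P ∨ b = i ∨ b = j) → x b = 0 := fun b hb => by
    push Not at hb; exact hx0 b hb.1 hb.2.2
  have hrow : ∀ y : V → ℝ, (∀ b, ¬ (b ∈ P ∨ b = i ∨ b = j) → y b = 0) →
      (∀ p ∈ P, (y ᵥ* S) p = 0) → ∀ a, ¬ (a ∈ C ∨ a = i ∨ a = j) → (y ᵥ* S) a = 0 := by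
    intro y hy hyP a ha
    push Not at ha
    by_cases haP : a ∈ P
    · exact hyP a haP
    · refine Finset.sum_eq_zero fun q _ => ?_
      by_cases hq : q ∈ P ∨ q = i ∨ q = j
      · simp [h0 q a hq haP ha.1 ha.2.1 ha.2.2]
      · simp [hy q hq]
  have hwa := hrow w hws hwP
  have hxa := hrow x hxs hxP
  set c := M j i / (x ᵥ* S) j with hc
  set N : Matrix V V ℝ := c • (vecMulVec (w ᵥ* S) x - vecMulVec (x ᵥ* S) w) with hN
  have hNab : ∀ a b, N a b = c * ((w ᵥ* S) a * x b - (x ᵥ* S) a * w b) := fun a b => by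
    simp [hN, vecMulVec_apply]
  have hNS : N * S = c • (vecMulVec (w ᵥ* S) (x ᵥ* S) - vecMulVec (x ᵥ* S) (w ᵥ* S)) := by
    rw [hN, smul_mul_assoc, sub_mul, vecMulVec_mul, vecMulVec_mul]
  have hskew : N * S + S * Nᵀ = 0 := by
    have : S * Nᵀ = (N * S)ᵀ := by rw [transpose_mul, posDef_symm hpd]
    rw [this, hNS, transpose_smul, transpose_sub, transpose_vecMulVec, transpose_vecMulVec,
      ← smul_add]
    simp
  refine mem_gclm_iff.2 ⟨hpd, M + N, ?_, ?_⟩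
  · intro b a hba
    rw [Matrix.add_apply]
    by_cases he : b = i ∧ a = j
    · obtain ⟨rfl, rfl⟩ := he
      rw [hNab, hx0 b hiP hij, hw1, hc]
      field_simp
      ring
    · rw [hM b a fun hadj => hba (hGH b a hadj he), zero_add, hNab]
      by_cases hb : b ∈ P ∨ b = i ∨ b = j
      · have ha : ¬ (a ∈ C ∨ a = i ∨ a = j) := fun ha => hba (hH b a hb ha he)
        rw [hwa a ha, hxa a ha]; simp
      · rw [hws b hb, hxs b hb]; simp
  · unfold LyapunovEq at hL ⊢
    rw [add_mul, transpose_add, mul_add, ← hL]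
    have : M * S + N * S + (S * Mᵀ + S * Nᵀ) + (2 : ℝ) • (1 : Matrix V V ℝ) =
      M * S + S * Mᵀ + (2 : ℝ) • (1 : Matrix V V ℝ) + (N * S + S * Nᵀ) := by abel
    rw [this, hskew, add_zero]

end Lyapunov

/-! ### Independence as vanishing covariance -/

section Gaussian

variable {V : Type*} [Fintype V] [DecidableEq V]

lemma indepFun_multivariateGaussian_iff {S : Matrix V V ℝ} (hS : S.PosDef) (k i j : V) :
    IndepFun (fun x : EuclideanSpace ℝ V => x k)
      (fun x : EuclideanSpace ℝ V => (x i, x j)) (multivariateGaussian 0 S) ↔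
    S i k = 0 ∧ S j k = 0 := by
  have hmem : ∀ v, MemLp (fun x : EuclideanSpace ℝ V => x v) 2 (multivariateGaussian 0 S) := by
    intro v
    exact (EuclideanSpace.proj (𝕜 := ℝ) v).comp_memLp' IsGaussian.memLp_two_id
  constructor
  · intro h
    rw [posDef_comm hS i k, posDef_comm hS j k,
      ← covariance_eval_multivariateGaussian (μ := 0) hS.posSemidef k i,
      ← covariance_eval_multivariateGaussian (μ := 0) hS.posSemidef k j]
    exact ⟨(h.comp measurable_id measurable_fst).covariance_eq_zero (hmem k) (hmem i),
      (h.comp measurable_id measurable_snd).covariance_eq_zero (hmem k) (hmem j)⟩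
  · rintro ⟨hi, hj⟩
    -- Uncorrelated jointly Gaussian families are independent; the scalar and the pair are viewed as
    -- families over `Fin 1` and `Fin 2`.
    have hg : HasGaussianLaw (fun x : EuclideanSpace ℝ V =>
        ((fun _ : Fin 1 => x k), (fun a : Fin 2 => x (![i, j] a)))) (multivariateGaussian 0 S) := by
      exact (IsGaussian.hasGaussianLaw_id (μ := multivariateGaussian 0 S)).map_fun
        ((ContinuousLinearMap.pi fun _ : Fin 1 => EuclideanSpace.proj (𝕜 := ℝ) k).prod
          (ContinuousLinearMap.pi fun a : Fin 2 => EuclideanSpace.proj (𝕜 := ℝ) (![i, j] a)))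
    have h := hg.indepFun_of_covariance_eval (X := fun _ (x : EuclideanSpace ℝ V) => x k)
      (Y := fun a (x : EuclideanSpace ℝ V) => x (![i, j] a)) fun _ b => by
        rw [covariance_eval_multivariateGaussian hS.posSemidef, posDef_comm hS]
        fin_cases b <;> simpa
    exact h.comp (φ := fun y : Fin 1 → ℝ => y 0) (ψ := fun y : Fin 2 → ℝ => (y 0, y 1))
      (by fun_prop) (by fun_prop)

end Gaussian

/-! ### Extension of small examples by independent coordinates -/

section Padding

variable {V : Type*} [Fintype V] [DecidableEq V] {m : Type*} [Fintype m] [DecidableEq m]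

/-- The matrix of the coordinate embedding along `f`. -/
def embedMatrix (f : m → V) : Matrix V m ℝ := Matrix.of fun v a => if v = f a then 1 else 0

/-- Extension of a matrix by the identity outside the range of `f`. -/
def pad (f : m → V) (S : Matrix m m ℝ) : Matrix V V ℝ :=
  1 + embedMatrix f * (S - 1) * (embedMatrix f)ᵀ

lemma embedMatrix_transpose_mul_self {f : m → V} (hf : Function.Injective f) :
    (embedMatrix f)ᵀ * embedMatrix f = 1 := by
  ext a b
  simp [Matrix.mul_apply, embedMatrix, Matrix.one_apply, hf.eq_iff, eq_comm]

lemma embedMatrix_compress (f : m → V) (A : Matrix V V ℝ) :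
    (embedMatrix f)ᵀ * A * embedMatrix f = A.submatrix f f := by
  ext a b
  simp [Matrix.mul_apply, embedMatrix]

lemma pad_mul_embedMatrix {f : m → V} (hf : Function.Injective f) (S : Matrix m m ℝ) :
    pad f S * embedMatrix f = embedMatrix f * S := by
  rw [pad, Matrix.add_mul, Matrix.mul_assoc, embedMatrix_transpose_mul_self hf, Matrix.mul_sub]
  simp

lemma pad_apply {f : m → V} (hf : Function.Injective f) (S : Matrix m m ℝ) (a b : m) :
    pad f S (f a) (f b) = S a b := by
  have h : (pad f S).submatrix f f = S := by
    rw [← embedMatrix_compress, Matrix.mul_assoc, pad_mul_embedMatrix hf, ← Matrix.mul_assoc,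
      embedMatrix_transpose_mul_self hf, Matrix.one_mul]
  exact congrFun (congrFun h a) b

lemma pad_posDef {f : m → V} (hf : Function.Injective f) {S : Matrix m m ℝ} (hS : S.PosDef) :
    (pad f S).PosDef := by
  set E := embedMatrix f with hE
  have hEE : Eᵀ * E = 1 := embedMatrix_transpose_mul_self hf
  refine Matrix.PosDef.of_dotProduct_mulVec_pos ?_ fun x hx => ?_
  · have : (pad f S)ᵀ = pad f S := by
      simp [pad, Matrix.transpose_mul, posDef_symm hS, Matrix.mul_assoc]
    simpa [Matrix.IsHermitian] using this
  · set y := x ᵥ* E with hy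
    have hxE : Eᵀ *ᵥ x = y := mulVec_transpose _ _
    have h1 : star x ⬝ᵥ (pad f S) *ᵥ x = x ⬝ᵥ x + (y ⬝ᵥ S *ᵥ y - y ⬝ᵥ y) := by
      rw [star_trivial, pad, add_mulVec, one_mulVec, dotProduct_add, ← mulVec_mulVec,
        ← mulVec_mulVec, dotProduct_mulVec x E, ← hE, hxE, sub_mulVec, one_mulVec, dotProduct_sub]
    -- Pythagoras for the projection onto the embedded coordinates: the form splits into the squared
    -- norm outside the range plus the form of `S` inside.
    have h2 : (x - E *ᵥ y) ⬝ᵥ (x - E *ᵥ y) = x ⬝ᵥ x - y ⬝ᵥ y := by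
      have e1 : x ⬝ᵥ E *ᵥ y = y ⬝ᵥ y := by rw [dotProduct_mulVec]
      have e2 : (E *ᵥ y) ⬝ᵥ (E *ᵥ y) = y ⬝ᵥ y := by
        rw [dotProduct_mulVec, ← mulVec_transpose, mulVec_mulVec, hEE, one_mulVec]
      have e3 : (E *ᵥ y) ⬝ᵥ x = y ⬝ᵥ y := by rw [dotProduct_comm, e1]
      rw [sub_dotProduct, dotProduct_sub, dotProduct_sub, e1, e2, e3]
      ring
    have h3 : 0 ≤ (x - E *ᵥ y) ⬝ᵥ (x - E *ᵥ y) :=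
      Finset.sum_nonneg fun i _ => mul_self_nonneg _
    rw [h1]
    by_cases hy0 : y = 0
    · have : 0 < x ⬝ᵥ x := lt_of_le_of_ne (Finset.sum_nonneg fun i _ => mul_self_nonneg _)
        fun h0 => hx (dotProduct_self_eq_zero.1 h0.symm)
      simpa [hy0] using this
    · have := hS.dotProduct_mulVec_pos hy0
      rw [star_trivial] at this
      linarith

/-- A covariance matrix of an induced subgraph extends to one of the whole graph. -/
lemma pad_mem_gclm {G : Digraph V} (hG : IsSimpleDAG G) {f : m → V} (hf : Function.Injective f)
    {S M : Matrix m m ℝ} (hS : S.PosDef) (hL : LyapunovEq M S)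
    (hM : ∀ a b, a ≠ b → M b a ≠ 0 → G.Adj (f a) (f b)) : pad f S ∈ gclm G := by
  set E := embedMatrix f with hE
  have hEE : Eᵀ * E = 1 := embedMatrix_transpose_mul_self hf
  -- This drift is `M` on the embedded vertices and `-1` on the diagonal elsewhere, the value
  -- matching unit variance and noise `2`.
  refine mem_gclm_iff.2 ⟨pad_posDef hf hS, -1 + E * (M + 1) * Eᵀ, ?_, ?_⟩
  · intro u v huv
    have hne : u ≠ v := by rintro rfl; exact huv (hG.loops u)
    have : (E * (M + 1) * Eᵀ : Matrix V V ℝ) v u = 0 := by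
      rw [Matrix.mul_apply]
      refine Finset.sum_eq_zero fun b _ => ?_
      rw [Matrix.mul_apply, Finset.sum_mul]
      refine Finset.sum_eq_zero fun a _ => ?_
      by_cases hv : v = f a
      · by_cases hu : u = f b
        · have hab : b ≠ a := by rintro rfl; exact hne (hu.trans hv.symm)
          have : M a b = 0 := by
            by_contra h
            exact huv (hu ▸ hv ▸ hM b a hab h)
          simp [this, Matrix.one_apply_ne hab.symm]
        · simp [hE, embedMatrix, hu]
      · simp [hE, embedMatrix, hv]
    simp [this, Matrix.one_apply_ne hne.symm]
  · have hprod : (-1 + E * (M + 1) * Eᵀ) * pad f S = -1 + E * (M * S + 1) * Eᵀ := by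
      have : E * (M + 1) * Eᵀ * (E * (S - 1) * Eᵀ) = E * ((M + 1) * (S - 1)) * Eᵀ := by
        calc _ = E * (M + 1) * (Eᵀ * E) * (S - 1) * Eᵀ := by simp only [Matrix.mul_assoc]
          _ = _ := by rw [hEE, Matrix.mul_one, Matrix.mul_assoc E]
      rw [pad, ← hE, Matrix.mul_add, Matrix.add_mul _ _ (E * (S - 1) * Eᵀ), this, Matrix.mul_one]
      have e : (M + 1) * (S - 1) = M * S + 1 - (M + 1) + (S - 1) := by noncomm_ring
      rw [e]
      simp only [Matrix.neg_mul, Matrix.one_mul, Matrix.mul_add, Matrix.add_mul, Matrix.mul_sub,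
        Matrix.sub_mul]
      abel
    have htr : pad f S * (-1 + E * (M + 1) * Eᵀ)ᵀ = -1 + E * (S * Mᵀ + 1) * Eᵀ := by
      rw [← posDef_symm (pad_posDef hf hS), ← transpose_mul, hprod]
      simp [transpose_mul, posDef_symm hS, Matrix.mul_assoc]
    have hL' : M * S + 1 + (S * Mᵀ + 1) = 0 := by
      rw [← hL, two_smul]; abel
    rw [LyapunovEq, hprod, htr]
    have : -1 + E * (M * S + 1) * Eᵀ + (-1 + E * (S * Mᵀ + 1) * Eᵀ) =
        -1 + -1 + E * (M * S + 1 + (S * Mᵀ + 1)) * Eᵀ := by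
      rw [Matrix.mul_add E (M * S + 1), Matrix.add_mul]; abel
    rw [this, hL', two_smul]
    simp

/-- The padded covariance preserves the range of the embedding, so compressing the equation to it
involves only the corresponding block of the drift. -/
lemma exists_drift_of_pad_mem {H : Digraph V} {f : m → V} (hf : Function.Injective f)
    {S : Matrix m m ℝ} (hS : S.PosDef) (h : pad f S ∈ gclm H) :
    ∃ M : Matrix m m ℝ, (∀ a b, ¬ H.Adj (f a) (f b) → M b a = 0) ∧ LyapunovEq M S := by
  obtain ⟨hpd, M, hM, hL⟩ := mem_gclm_iff.1 h
  refine ⟨M.submatrix f f, fun a b hab => hM _ _ hab, ?_⟩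
  set E := embedMatrix f with hE
  have h1 : Eᵀ * (M * pad f S) * E = M.submatrix f f * S := by
    rw [← embedMatrix_compress, ← hE, Matrix.mul_assoc, Matrix.mul_assoc M,
      pad_mul_embedMatrix hf]
    simp only [Matrix.mul_assoc, hE]
  have h2 : Eᵀ * (pad f S * Mᵀ) * E = S * (M.submatrix f f)ᵀ := by
    have : Eᵀ * (pad f S * Mᵀ) * E = (Eᵀ * (M * pad f S) * E)ᵀ := by
      simp [transpose_mul, posDef_symm hpd, Matrix.mul_assoc]
    rw [this, h1, transpose_mul, posDef_symm hS]
  have h3 := congrArg (fun A => Eᵀ * A * E) hL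
  simp only [Matrix.mul_add, Matrix.add_mul, h1, h2, Matrix.mul_smul, Matrix.smul_mul,
    Matrix.mul_one, Matrix.mul_zero, Matrix.zero_mul] at h3
  rwa [hE, embedMatrix_transpose_mul_self hf] at h3

/-- If the model of `G` is contained in that of `H`, the same holds for induced subgraphs. -/
lemma exists_drift_of_gclm_subset {G H : Digraph V} (hG : IsSimpleDAG G)
    (hGH : gclm G ⊆ gclm H) {f : m → V} (hf : Function.Injective f)
    {S M : Matrix m m ℝ} (hS : S.PosDef) (hL : LyapunovEq M S)
    (hM : ∀ a b, a ≠ b → M b a ≠ 0 → G.Adj (f a) (f b)) :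
    ∃ M' : Matrix m m ℝ, (∀ a b, ¬ H.Adj (f a) (f b) → M' b a = 0) ∧ LyapunovEq M' S :=
  exists_drift_of_pad_mem hf hS (hGH (pad_mem_gclm hG hf hS hL hM))

end Padding

/-! ### Explicit small drifts and covariances -/

section Witnesses

variable {V : Type*} [Fintype V] [DecidableEq V]

lemma lyapunovEq_iff {M S : Matrix V V ℝ} : LyapunovEq M S ↔
    ∀ a b, ∑ l, M a l * S l b + ∑ l, S a l * M b l + 2 * (if a = b then 1 else 0) = 0 := by
  simp [LyapunovEq, ← Matrix.ext_iff, Matrix.mul_apply, Matrix.one_apply]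

/-- In this form definiteness is shown by killing coordinates one at a time, bounding the form below
by sums of squares. -/
lemma posDef_of_quadratic {n : ℕ} {S : Matrix (Fin n) (Fin n) ℝ} (hS : Sᵀ = S)
    (h : ∀ x : Fin n → ℝ, x ⬝ᵥ S *ᵥ x ≤ 0 → x = 0) : S.PosDef := by
  refine Matrix.PosDef.of_dotProduct_mulVec_pos (by simpa [Matrix.IsHermitian] using hS)
    fun x hx => ?_
  by_contra hc
  exact hx (h x (not_lt.1 hc))

lemma eq_zero_of_sq_nonpos {x : ℝ} (h : x ^ 2 ≤ 0) : x = 0 :=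
  pow_eq_zero_iff two_ne_zero |>.1 (le_antisymm h (sq_nonneg x))

/-- Drift and covariance of a single edge `0 → 1`. -/
def edgeDrift : Matrix (Fin 2) (Fin 2) ℝ := !![-1, 0; 2, -1]

def edgeCov : Matrix (Fin 2) (Fin 2) ℝ := !![1, 1; 1, 3]

lemma edgeCov_posDef : edgeCov.PosDef := by
  refine posDef_of_quadratic (by ext a b; fin_cases a <;> fin_cases b <;> rfl) fun x hx => ?_
  simp only [dotProduct, mulVec, edgeCov, Fin.sum_univ_two, of_apply, cons_val', cons_val_zero,
    cons_val_one] at hx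
  have h1 : x 1 = 0 := eq_zero_of_sq_nonpos (by nlinarith [sq_nonneg (x 0 + x 1)])
  have h0 : x 0 = 0 := eq_zero_of_sq_nonpos (by rw [h1] at hx; nlinarith)
  ext a; fin_cases a <;> assumption

lemma edge_lyapunovEq : LyapunovEq edgeDrift edgeCov := by
  refine lyapunovEq_iff.2 fun a b => ?_
  fin_cases a <;> fin_cases b <;> norm_num [edgeDrift, edgeCov, Fin.sum_univ_two]

/-- Drift and covariance of a chain `0 → 1 → 2`. -/
def chainDrift : Matrix (Fin 3) (Fin 3) ℝ := !![-1, 0, 0; 2, -1, 0; 0, 2, -1]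

def chainCov : Matrix (Fin 3) (Fin 3) ℝ := !![1, 1, 1; 1, 3, 4; 1, 4, 9]

lemma chainCov_posDef : chainCov.PosDef := by
  refine posDef_of_quadratic (by ext a b; fin_cases a <;> fin_cases b <;> rfl) fun x hx => ?_
  simp [dotProduct, mulVec, chainCov, Fin.sum_univ_three] at hx
  have h2 : x 2 = 0 := eq_zero_of_sq_nonpos (by
    nlinarith [sq_nonneg (x 0 + x 1 + x 2), sq_nonneg (2 * x 1 + 3 * x 2)])
  rw [h2] at hx
  have h1 : x 1 = 0 := eq_zero_of_sq_nonpos (by nlinarith [sq_nonneg (x 0 + x 1)])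
  rw [h1] at hx
  have h0 : x 0 = 0 := eq_zero_of_sq_nonpos (by nlinarith)
  ext a; fin_cases a <;> assumption

lemma chain_lyapunovEq : LyapunovEq chainDrift chainCov := by
  refine lyapunovEq_iff.2 fun a b => ?_
  fin_cases a <;> fin_cases b <;>
    simp [chainDrift, chainCov, Fin.sum_univ_three] <;> norm_num

/-- Drift and covariance of a fork `0 ← 1 → 2`. -/
def forkDrift : Matrix (Fin 3) (Fin 3) ℝ := !![-1, 2, 0; 0, -1, 0; 0, 2, -1]

def forkCov : Matrix (Fin 3) (Fin 3) ℝ := !![3, 1, 2; 1, 1, 1; 2, 1, 3]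

lemma forkCov_posDef : forkCov.PosDef := by
  refine posDef_of_quadratic (by ext a b; fin_cases a <;> fin_cases b <;> rfl) fun x hx => ?_
  simp [dotProduct, mulVec, forkCov, Fin.sum_univ_three] at hx
  have h2 : x 2 = 0 := eq_zero_of_sq_nonpos (by
    nlinarith [sq_nonneg (x 0 + x 1 + x 2), sq_nonneg (2 * x 0 + x 2)])
  rw [h2] at hx
  have h0 : x 0 = 0 := eq_zero_of_sq_nonpos (by nlinarith [sq_nonneg (x 0 + x 1)])
  rw [h0] at hx
  have h1 : x 1 = 0 := eq_zero_of_sq_nonpos (by nlinarith)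
  ext a; fin_cases a <;> assumption

lemma fork_lyapunovEq : LyapunovEq forkDrift forkCov := by
  refine lyapunovEq_iff.2 fun a b => ?_
  fin_cases a <;> fin_cases b <;>
    simp [forkDrift, forkCov, Fin.sum_univ_three] <;> norm_num

/-- Drift and covariance of `0 → 2 ← 1 → 3`. -/
def diamondDrift : Matrix (Fin 4) (Fin 4) ℝ :=
  !![-1, 0, 0, 0; 0, -1, 0, 0; 2, 2, -1, 0; 0, 2, 0, -1]

def diamondCov : Matrix (Fin 4) (Fin 4) ℝ :=
  !![1, 0, 1, 0; 0, 1, 1, 1; 1, 1, 5, 2; 0, 1, 2, 3]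

lemma diamondCov_posDef : diamondCov.PosDef := by
  refine posDef_of_quadratic (by ext a b; fin_cases a <;> fin_cases b <;> rfl) fun x hx => ?_
  simp [dotProduct, mulVec, diamondCov, Fin.sum_univ_four] at hx
  have h3 : x 3 = 0 := eq_zero_of_sq_nonpos (by
    nlinarith [sq_nonneg (x 0 + x 2), sq_nonneg (x 1 + x 2 + x 3), sq_nonneg (3 * x 2 + x 3)])
  rw [h3] at hx
  have h2 : x 2 = 0 := eq_zero_of_sq_nonpos (by
    nlinarith [sq_nonneg (x 0 + x 2), sq_nonneg (x 1 + x 2)])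
  rw [h2] at hx
  have h1 : x 1 = 0 := eq_zero_of_sq_nonpos (by nlinarith [sq_nonneg (x 0)])
  have h0 : x 0 = 0 := eq_zero_of_sq_nonpos (by nlinarith [sq_nonneg (x 1)])
  ext a; fin_cases a <;> assumption

lemma diamond_lyapunovEq : LyapunovEq diamondDrift diamondCov := by
  refine lyapunovEq_iff.2 fun a b => ?_
  fin_cases a <;> fin_cases b <;>
    simp [diamondDrift, diamondCov, Fin.sum_univ_four] <;> norm_num

/-- Drift and covariance of `1 → 2`, `1 → 3`, `2 → 3`, `3 → 0`. -/
def descendantDrift : Matrix (Fin 4) (Fin 4) ℝ :=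
  !![-1, 0, 0, 2; 0, -1, 0, 0; 0, -2, -1, 0; 0, 2, 2, -1]

/-- The weight `-2` on `1 → 2` makes the effects of `1 → 3` and `1 → 2 → 3` cancel, so `1` is
uncorrelated with its descendants `3` and `0`. -/
def descendantCov : Matrix (Fin 4) (Fin 4) ℝ :=
  !![15, 0, 2, 7; 0, 1, -1, 0; 2, -1, 3, 2; 7, 0, 2, 5]

lemma descendantCov_posDef : descendantCov.PosDef := by
  refine posDef_of_quadratic (by ext a b; fin_cases a <;> fin_cases b <;> rfl) fun x hx => ?_
  simp [dotProduct, mulVec, descendantCov, Fin.sum_univ_four] at hx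
  have h0 : x 0 = 0 := eq_zero_of_sq_nonpos (by
    nlinarith [sq_nonneg (x 1 - x 2), sq_nonneg (x 0 + x 2 + x 3), sq_nonneg (2 * x 0 + x 3)])
  rw [h0] at hx
  have h3 : x 3 = 0 := eq_zero_of_sq_nonpos (by
    nlinarith [sq_nonneg (x 1 - x 2), sq_nonneg (x 2 + x 3)])
  rw [h3] at hx
  have h2 : x 2 = 0 := eq_zero_of_sq_nonpos (by nlinarith [sq_nonneg (x 1 - x 2)])
  rw [h2] at hx
  have h1 : x 1 = 0 := eq_zero_of_sq_nonpos (by nlinarith)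
  ext a; fin_cases a <;> assumption

lemma descendant_lyapunovEq : LyapunovEq descendantDrift descendantCov := by
  refine lyapunovEq_iff.2 fun a b => ?_
  fin_cases a <;> fin_cases b <;>
    simp [descendantDrift, descendantCov, Fin.sum_univ_four] <;> norm_num

/-- Drift and covariance of `0 → 3 → 2 ← 1`. -/
def ancestorDrift : Matrix (Fin 4) (Fin 4) ℝ :=
  !![-1, 0, 0, 0; 0, -1, 0, 0; 0, 2, -1, 2; 2, 0, 0, -1]

def ancestorCov : Matrix (Fin 4) (Fin 4) ℝ :=
  !![1, 0, 1, 1; 0, 1, 1, 0; 1, 1, 11, 4; 1, 0, 4, 3]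

lemma ancestorCov_posDef : ancestorCov.PosDef := by
  refine posDef_of_quadratic (by ext a b; fin_cases a <;> fin_cases b <;> rfl) fun x hx => ?_
  simp [dotProduct, mulVec, ancestorCov, Fin.sum_univ_four] at hx
  have h2 : x 2 = 0 := eq_zero_of_sq_nonpos (by
    nlinarith [sq_nonneg (x 0 + x 2 + x 3), sq_nonneg (x 1 + x 2), sq_nonneg (2 * x 3 + 3 * x 2)])
  rw [h2] at hx
  have h3 : x 3 = 0 := eq_zero_of_sq_nonpos (by
    nlinarith [sq_nonneg (x 0 + x 3), sq_nonneg (x 1)])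
  rw [h3] at hx
  have h1 : x 1 = 0 := eq_zero_of_sq_nonpos (by nlinarith [sq_nonneg (x 0)])
  have h0 : x 0 = 0 := eq_zero_of_sq_nonpos (by nlinarith [sq_nonneg (x 1)])
  ext a; fin_cases a <;> assumption

lemma ancestor_lyapunovEq : LyapunovEq ancestorDrift ancestorCov := by
  refine lyapunovEq_iff.2 fun a b => ?_
  fin_cases a <;> fin_cases b <;>
    simp [ancestorDrift, ancestorCov, Fin.sum_univ_four] <;> norm_num

/-- Drift and covariance of `0 ← 3 → 2 ← 1`. -/
def siblingDrift : Matrix (Fin 4) (Fin 4) ℝ :=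
  !![-1, 0, 0, 2; 0, -1, 0, 0; 0, 2, -1, 2; 0, 0, 0, -1]

def siblingCov : Matrix (Fin 4) (Fin 4) ℝ :=
  !![3, 0, 2, 1; 0, 1, 1, 0; 2, 1, 5, 1; 1, 0, 1, 1]

lemma siblingCov_posDef : siblingCov.PosDef := by
  refine posDef_of_quadratic (by ext a b; fin_cases a <;> fin_cases b <;> rfl) fun x hx => ?_
  simp [dotProduct, mulVec, siblingCov, Fin.sum_univ_four] at hx
  have h2 : x 2 = 0 := eq_zero_of_sq_nonpos (by
    nlinarith [sq_nonneg (x 0 + x 2 + x 3), sq_nonneg (x 1 + x 2), sq_nonneg (2 * x 0 + x 2)])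
  rw [h2] at hx
  have h0 : x 0 = 0 := eq_zero_of_sq_nonpos (by
    nlinarith [sq_nonneg (x 0 + x 3), sq_nonneg (x 1)])
  rw [h0] at hx
  have h1 : x 1 = 0 := eq_zero_of_sq_nonpos (by nlinarith [sq_nonneg (x 3)])
  have h3 : x 3 = 0 := eq_zero_of_sq_nonpos (by nlinarith [sq_nonneg (x 1)])
  ext a; fin_cases a <;> assumption

lemma sibling_lyapunovEq : LyapunovEq siblingDrift siblingCov := by
  refine lyapunovEq_iff.2 fun a b => ?_
  fin_cases a <;> fin_cases b <;>
    simp [siblingDrift, siblingCov, Fin.sum_univ_four] <;> norm_num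

lemma injective_vec_two {a b : V} (hab : a ≠ b) : Function.Injective ![a, b] := by
  intro x y
  fin_cases x <;> fin_cases y <;> simp [hab, hab.symm]

lemma injective_vec_three {a b c : V} (hab : a ≠ b) (hac : a ≠ c) (hbc : b ≠ c) :
    Function.Injective ![a, b, c] := by
  intro x y
  fin_cases x <;> fin_cases y <;> simp [hab, hab.symm, hac, hac.symm, hbc, hbc.symm]

lemma injective_vec_four {a b c d : V} (hab : a ≠ b) (hac : a ≠ c) (had : a ≠ d) (hbc : b ≠ c)
    (hbd : b ≠ d) (hcd : c ≠ d) : Function.Injective ![a, b, c, d] := by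
  intro x y
  fin_cases x <;> fin_cases y <;>
    simp [hab, hab.symm, hac, hac.symm, had, had.symm, hbc, hbc.symm, hbd, hbd.symm, hcd, hcd.symm]

end Witnesses

/-! ### What the model determines about the graph -/

section Separation

variable {V : Type*} [Fintype V] [DecidableEq V] {G H : Digraph V}

lemma exists_cov_ne_zero_of_chain (hG : IsSimpleDAG G) {a b c : V} (hab : a ≠ b) (hac : a ≠ c)
    (hbc : b ≠ c) (h₁ : G.Adj a b) (h₂ : G.Adj b c) : ∃ S ∈ gclm G, S a c ≠ 0 := by
  have hf := injective_vec_three hab hac hbc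
  refine ⟨pad ![a, b, c] chainCov, pad_mem_gclm hG hf chainCov_posDef chain_lyapunovEq ?_, ?_⟩
  · intro x y hxy
    fin_cases x <;> fin_cases y <;> simp [chainDrift, h₁, h₂] at hxy ⊢
  · have := pad_apply hf chainCov 0 2
    simp only [cons_val_zero, cons_val] at this
    rw [this]
    simp [chainCov]

lemma exists_cov_ne_zero_of_fork (hG : IsSimpleDAG G) {a b c : V} (hab : a ≠ b) (hac : a ≠ c)
    (hbc : b ≠ c) (h₁ : G.Adj b a) (h₂ : G.Adj b c) : ∃ S ∈ gclm G, S a c ≠ 0 := by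
  have hf := injective_vec_three hab hac hbc
  refine ⟨pad ![a, b, c] forkCov, pad_mem_gclm hG hf forkCov_posDef fork_lyapunovEq ?_, ?_⟩
  · intro x y hxy
    fin_cases x <;> fin_cases y <;> simp [forkDrift, h₁, h₂] at hxy ⊢
  · have := pad_apply hf forkCov 0 2
    simp only [cons_val_zero, cons_val] at this
    rw [this]
    simp [forkCov]

/-- Without an edge in `H` the two-vertex drift is diagonal with negative entries, contradicting the
nonzero covariance. -/
lemma adj_or_adj_of_gclm_subset (hG : IsSimpleDAG G) (hGH : gclm G ⊆ gclm H) {a b : V}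
    (hab : a ≠ b) (h : G.Adj a b) : H.Adj a b ∨ H.Adj b a := by
  by_contra hc
  push Not at hc
  obtain ⟨M, hM, hL⟩ := exists_drift_of_gclm_subset hG hGH (injective_vec_two hab)
    edgeCov_posDef edge_lyapunovEq (by
      intro x y hxy
      fin_cases x <;> fin_cases y <;> simp [edgeDrift, h] at hxy ⊢)
  have z10 : M 1 0 = 0 := hM 0 1 (by simpa using hc.1)
  have z01 : M 0 1 = 0 := hM 1 0 (by simpa using hc.2)
  rw [lyapunovEq_iff] at hL
  have e00 := hL 0 0
  have e01 := hL 0 1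
  have e11 := hL 1 1
  simp [edgeCov, Fin.sum_univ_two, z10, z01] at e00 e01 e11
  linarith

lemma adj_of_chain (hG : IsSimpleDAG G) (hGH : gclm G ⊆ gclm H) (hH : IsSimpleDAG H)
    {a b c : V} (hab : a ≠ b) (hac : a ≠ c) (hbc : b ≠ c) (h₁ : G.Adj a b) (h₂ : G.Adj b c)
    (h₃ : ¬ H.Adj a c) (h₄ : ¬ H.Adj c a) : H.Adj a b ∧ H.Adj b c := by
  obtain ⟨M, hM, hL⟩ := exists_drift_of_gclm_subset hG hGH (injective_vec_three hab hac hbc)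
    chainCov_posDef chain_lyapunovEq (by
      intro x y hxy
      fin_cases x <;> fin_cases y <;> simp [chainDrift, h₁, h₂] at hxy ⊢)
  have z20 : M 2 0 = 0 := hM 0 2 (by simpa using h₃)
  have z02 : M 0 2 = 0 := hM 2 0 (by simpa using h₄)
  have s01 : M 1 0 = 0 ∨ M 0 1 = 0 := by
    by_cases h : H.Adj a b
    · exact Or.inr (hM 1 0 fun h' => hH.simple a b hab ⟨h, h'⟩)
    · exact Or.inl (hM 0 1 h)
  have s12 : M 2 1 = 0 ∨ M 1 2 = 0 := by
    by_cases h : H.Adj b c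
    · exact Or.inr (hM 2 1 fun h' => hH.simple b c hbc ⟨h, h'⟩)
    · exact Or.inl (hM 1 2 h)
  rw [lyapunovEq_iff] at hL
  have e00 := hL 0 0
  have e01 := hL 0 1
  have e02 := hL 0 2
  have e11 := hL 1 1
  have e12 := hL 1 2
  have e22 := hL 2 2
  simp [chainCov, Fin.sum_univ_three, z20, z02] at e00 e01 e02 e11 e12 e22
  by_contra hc
  -- Any other orientation loses one of the two forward coefficients; each resulting sign pattern
  -- makes the linear system inconsistent.
  have : M 1 0 = 0 ∨ M 2 1 = 0 := by
    by_contra h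
    push Not at h
    exact hc ⟨by by_contra h'; exact h.1 (hM 0 1 h'), by by_contra h'; exact h.2 (hM 1 2 h')⟩
  rcases s01 with z01 | z01 <;> rcases s12 with z12 | z12 <;> rcases this with z | z <;>
    simp only [z01, z12, z] at e00 e01 e02 e11 e12 e22 <;> linarith

/-- A fork cannot become a collider, whose two sources would be uncorrelated. -/
lemma adj_or_adj_of_fork (hG : IsSimpleDAG G) (hGH : gclm G ⊆ gclm H)
    {a b c : V} (hab : a ≠ b) (hac : a ≠ c) (hbc : b ≠ c) (h₁ : G.Adj b a) (h₂ : G.Adj b c)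
    (h₃ : ¬ H.Adj a c) (h₄ : ¬ H.Adj c a) : H.Adj b a ∨ H.Adj b c := by
  by_contra hc
  push Not at hc
  obtain ⟨M, hM, hL⟩ := exists_drift_of_gclm_subset hG hGH (injective_vec_three hab hac hbc)
    forkCov_posDef fork_lyapunovEq (by
      intro x y hxy
      fin_cases x <;> fin_cases y <;> simp [forkDrift, h₁, h₂] at hxy ⊢)
  have z20 : M 2 0 = 0 := hM 0 2 h₃
  have z02 : M 0 2 = 0 := hM 2 0 h₄
  have z01 : M 0 1 = 0 := hM 1 0 hc.1
  have z21 : M 2 1 = 0 := hM 1 2 hc.2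
  rw [lyapunovEq_iff] at hL
  have e00 := hL 0 0
  have e02 := hL 0 2
  have e22 := hL 2 2
  simp [forkCov, Fin.sum_univ_three, z20, z02, z01, z21] at e00 e02 e22
  linarith

/-- The orientation of an unshielded path of two edges is determined by the model. -/
lemma adj_of_unshielded (hG : IsSimpleDAG G) (hH : IsSimpleDAG H) (hGH : gclm G = gclm H)
    {a b c : V} (hab : a ≠ b) (hac : a ≠ c) (hbc : b ≠ c) (h₁ : G.Adj a b)
    (h₂ : G.Adj b c ∨ G.Adj c b) (h₃ : ¬ G.Adj a c) (h₄ : ¬ G.Adj c a) : H.Adj a b := by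
  have hn : ¬ H.Adj a c ∧ ¬ H.Adj c a := by
    constructor <;> intro h
    · exact (adj_or_adj_of_gclm_subset hH hGH.ge hac h).elim h₃ h₄
    · exact (adj_or_adj_of_gclm_subset hH hGH.ge hac.symm h).elim h₄ h₃
  rcases h₂ with h₂ | h₂
  · exact (adj_of_chain hG hGH.le hH hab hac hbc h₁ h₂ hn.1 hn.2).1
  -- For a collider in `G`, reversing `a → b` would make the path a chain or a fork in `H`; read
  -- from `H` to `G`, neither can become a collider.
  · by_contra hc
    have hba : H.Adj b a := (adj_or_adj_of_gclm_subset hG hGH.le hab h₁).resolve_left hc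
    rcases adj_or_adj_of_gclm_subset hG hGH.le hbc.symm h₂ with h | h
    · have := adj_of_chain hH hGH.ge hG hbc.symm hac.symm hab.symm h hba h₄ h₃
      exact hG.simple a b hab ⟨h₁, this.2⟩
    · rcases adj_or_adj_of_fork hH hGH.ge hab hac hbc hba h h₃ h₄ with h | h
      · exact hG.simple a b hab ⟨h₁, h⟩
      · exact hG.simple b c hbc ⟨h, h₂⟩

/-- In the witness `k` is correlated with `j` but not with `i` or `l`, so the `(k, l)` entry kills
the coefficient of `j → l`; the remaining linear equations are inconsistent. -/
lemma false_of_diamond (hG : IsSimpleDAG G) (hGH : gclm G ⊆ gclm H) (hH : IsSimpleDAG H)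
    {k i j l : V} (hf : Function.Injective ![k, i, j, l])
    (g02 : G.Adj k j)
    (g13 : G.Adj i l)
    (g12 : G.Adj i j)
    (h01 : H.Adj k i)
    (h02 : H.Adj k j)
    (h13 : H.Adj i l)
    (h23 : H.Adj j l)
    (h21 : H.Adj j i)
    (n03 : ¬ H.Adj k l) (n30 : ¬ H.Adj l k) : False := by
  obtain ⟨M, hM, hL⟩ := exists_drift_of_gclm_subset hG hGH hf
    diamondCov_posDef diamond_lyapunovEq (by
      intro x y hxy
      fin_cases x <;> fin_cases y <;> simp [diamondDrift, g02, g13, g12] at hxy ⊢)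
  have z01 : M 0 1 = 0 :=
    hM 1 0 fun h => hH.simple _ _ (hf.ne (by decide : (0 : Fin 4) ≠ 1)) ⟨h01, h⟩
  have z02 : M 0 2 = 0 :=
    hM 2 0 fun h => hH.simple _ _ (hf.ne (by decide : (0 : Fin 4) ≠ 2)) ⟨h02, h⟩
  have z13 : M 1 3 = 0 :=
    hM 3 1 fun h => hH.simple _ _ (hf.ne (by decide : (1 : Fin 4) ≠ 3)) ⟨h13, h⟩
  have z23 : M 2 3 = 0 :=
    hM 3 2 fun h => hH.simple _ _ (hf.ne (by decide : (2 : Fin 4) ≠ 3)) ⟨h23, h⟩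
  have z21 : M 2 1 = 0 :=
    hM 1 2 fun h => hH.simple _ _ (hf.ne (by decide : (2 : Fin 4) ≠ 1)) ⟨h21, h⟩
  have z03 : M 0 3 = 0 := hM 3 0 n30
  have z30 : M 3 0 = 0 := hM 0 3 n03
  rw [lyapunovEq_iff] at hL
  have e00 := hL 0 0
  have e01 := hL 0 1
  have e02 := hL 0 2
  have e03 := hL 0 3
  have e11 := hL 1 1
  have e12 := hL 1 2
  have e13 := hL 1 3
  have e22 := hL 2 2
  have e23 := hL 2 3
  have e33 := hL 3 3
  simp [diamondCov, Fin.sum_univ_four, z01, z02, z13, z23, z21, z03, z30]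
    at e00 e01 e02 e03 e11 e12 e13 e22 e23 e33
  linarith

/-- As `i` is uncorrelated with `k` and `l` while `j` is correlated with `k`, the `(k, i)` entry
kills the coefficient of `j → i`. Then the `(i, j)` entry contradicts the two diagonal ones. -/
lemma false_of_descendant (hG : IsSimpleDAG G) (hGH : gclm G ⊆ gclm H) (hH : IsSimpleDAG H)
    {k i j l : V} (hf : Function.Injective ![k, i, j, l])
    (g13 : G.Adj i l)
    (g23 : G.Adj j l)
    (g30 : G.Adj l k)
    (g12 : G.Adj i j)
    (h13 : H.Adj i l)
    (h23 : H.Adj j l)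
    (h30 : H.Adj l k)
    (h21 : H.Adj j i)
    (n01 : ¬ H.Adj k i) (n10 : ¬ H.Adj i k)
    (n02 : ¬ H.Adj k j) (n20 : ¬ H.Adj j k) : False := by
  obtain ⟨M, hM, hL⟩ := exists_drift_of_gclm_subset hG hGH hf
    descendantCov_posDef descendant_lyapunovEq (by
      intro x y hxy
      fin_cases x <;> fin_cases y <;> simp [descendantDrift, g13, g23, g30, g12] at hxy ⊢)
  have z13 : M 1 3 = 0 :=
    hM 3 1 fun h => hH.simple _ _ (hf.ne (by decide : (1 : Fin 4) ≠ 3)) ⟨h13, h⟩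
  have z23 : M 2 3 = 0 :=
    hM 3 2 fun h => hH.simple _ _ (hf.ne (by decide : (2 : Fin 4) ≠ 3)) ⟨h23, h⟩
  have z30 : M 3 0 = 0 :=
    hM 0 3 fun h => hH.simple _ _ (hf.ne (by decide : (3 : Fin 4) ≠ 0)) ⟨h30, h⟩
  have z21 : M 2 1 = 0 :=
    hM 1 2 fun h => hH.simple _ _ (hf.ne (by decide : (2 : Fin 4) ≠ 1)) ⟨h21, h⟩
  have z01 : M 0 1 = 0 := hM 1 0 n10
  have z10 : M 1 0 = 0 := hM 0 1 n01
  have z02 : M 0 2 = 0 := hM 2 0 n20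
  have z20 : M 2 0 = 0 := hM 0 2 n02
  rw [lyapunovEq_iff] at hL
  have e00 := hL 0 0
  have e01 := hL 0 1
  have e02 := hL 0 2
  have e03 := hL 0 3
  have e11 := hL 1 1
  have e12 := hL 1 2
  have e13 := hL 1 3
  have e22 := hL 2 2
  have e23 := hL 2 3
  have e33 := hL 3 3
  simp [descendantCov, Fin.sum_univ_four, z13, z23, z30, z21, z01, z10, z02, z20]
    at e00 e01 e02 e03 e11 e12 e13 e22 e23 e33
  linarith

/-- The witness leaves `i` uncorrelated with `k` and `l`. The `(k, i)` and `(i, l)` entries are then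
independent equations for the coefficients of `j → i` and `l → i`, so both vanish and the rest is
inconsistent. `false_of_sibling` works the same way. -/
lemma false_of_ancestor (hG : IsSimpleDAG G) (hGH : gclm G ⊆ gclm H) (hH : IsSimpleDAG H)
    {k i j l : V} (hf : Function.Injective ![k, i, j, l])
    (g03 : G.Adj k l)
    (g32 : G.Adj l j)
    (g12 : G.Adj i j)
    (h03 : H.Adj k l)
    (h31 : H.Adj l i)
    (h32 : H.Adj l j)
    (h21 : H.Adj j i)
    (n01 : ¬ H.Adj k i) (n10 : ¬ H.Adj i k)
    (n02 : ¬ H.Adj k j) (n20 : ¬ H.Adj j k) : False := by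
  obtain ⟨M, hM, hL⟩ := exists_drift_of_gclm_subset hG hGH hf
    ancestorCov_posDef ancestor_lyapunovEq (by
      intro x y hxy
      fin_cases x <;> fin_cases y <;> simp [ancestorDrift, g03, g32, g12] at hxy ⊢)
  have z03 : M 0 3 = 0 :=
    hM 3 0 fun h => hH.simple _ _ (hf.ne (by decide : (0 : Fin 4) ≠ 3)) ⟨h03, h⟩
  have z31 : M 3 1 = 0 :=
    hM 1 3 fun h => hH.simple _ _ (hf.ne (by decide : (3 : Fin 4) ≠ 1)) ⟨h31, h⟩
  have z32 : M 3 2 = 0 :=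
    hM 2 3 fun h => hH.simple _ _ (hf.ne (by decide : (3 : Fin 4) ≠ 2)) ⟨h32, h⟩
  have z21 : M 2 1 = 0 :=
    hM 1 2 fun h => hH.simple _ _ (hf.ne (by decide : (2 : Fin 4) ≠ 1)) ⟨h21, h⟩
  have z01 : M 0 1 = 0 := hM 1 0 n10
  have z10 : M 1 0 = 0 := hM 0 1 n01
  have z02 : M 0 2 = 0 := hM 2 0 n20
  have z20 : M 2 0 = 0 := hM 0 2 n02
  rw [lyapunovEq_iff] at hL
  have e00 := hL 0 0
  have e01 := hL 0 1
  have e02 := hL 0 2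
  have e03 := hL 0 3
  have e11 := hL 1 1
  have e12 := hL 1 2
  have e13 := hL 1 3
  have e22 := hL 2 2
  have e23 := hL 2 3
  have e33 := hL 3 3
  simp [ancestorCov, Fin.sum_univ_four, z03, z31, z32, z21, z01, z10, z02, z20]
    at e00 e01 e02 e03 e11 e12 e13 e22 e23 e33
  linarith

lemma false_of_sibling (hG : IsSimpleDAG G) (hGH : gclm G ⊆ gclm H) (hH : IsSimpleDAG H)
    {k i j l : V} (hf : Function.Injective ![k, i, j, l])
    (g30 : G.Adj l k)
    (g32 : G.Adj l j)
    (g12 : G.Adj i j)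
    (h30 : H.Adj l k)
    (h31 : H.Adj l i)
    (h32 : H.Adj l j)
    (h21 : H.Adj j i)
    (n01 : ¬ H.Adj k i) (n10 : ¬ H.Adj i k)
    (n02 : ¬ H.Adj k j) (n20 : ¬ H.Adj j k) : False := by
  obtain ⟨M, hM, hL⟩ := exists_drift_of_gclm_subset hG hGH hf
    siblingCov_posDef sibling_lyapunovEq (by
      intro x y hxy
      fin_cases x <;> fin_cases y <;> simp [siblingDrift, g30, g32, g12] at hxy ⊢)
  have z30 : M 3 0 = 0 :=
    hM 0 3 fun h => hH.simple _ _ (hf.ne (by decide : (3 : Fin 4) ≠ 0)) ⟨h30, h⟩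
  have z31 : M 3 1 = 0 :=
    hM 1 3 fun h => hH.simple _ _ (hf.ne (by decide : (3 : Fin 4) ≠ 1)) ⟨h31, h⟩
  have z32 : M 3 2 = 0 :=
    hM 2 3 fun h => hH.simple _ _ (hf.ne (by decide : (3 : Fin 4) ≠ 2)) ⟨h32, h⟩
  have z21 : M 2 1 = 0 :=
    hM 1 2 fun h => hH.simple _ _ (hf.ne (by decide : (2 : Fin 4) ≠ 1)) ⟨h21, h⟩
  have z01 : M 0 1 = 0 := hM 1 0 n10
  have z10 : M 1 0 = 0 := hM 0 1 n01
  have z02 : M 0 2 = 0 := hM 2 0 n20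
  have z20 : M 2 0 = 0 := hM 0 2 n02
  rw [lyapunovEq_iff] at hL
  have e00 := hL 0 0
  have e01 := hL 0 1
  have e02 := hL 0 2
  have e03 := hL 0 3
  have e11 := hL 1 1
  have e12 := hL 1 2
  have e13 := hL 1 3
  have e22 := hL 2 2
  have e23 := hL 2 3
  have e33 := hL 3 3
  simp [siblingCov, Fin.sum_univ_four, z30, z31, z32, z21, z01, z10, z02, z20]
    at e00 e01 e02 e03 e11 e12 e13 e22 e23 e33
  linarith

end Separation

/-! ### Closed covers and invariance of the model under flips -/

section Flips

variable {V : Type*} [Fintype V] [DecidableEq V] {G H : Digraph V} {i j : V}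

lemma IsSimpleDAG.no_triangle (hG : IsSimpleDAG G) {a b c : V} (hab : a ≠ b) (hbc : b ≠ c)
    (hca : c ≠ a) (h₁ : G.Adj a b) (h₂ : G.Adj b c) (h₃ : G.Adj c a) : False :=
  hG.acyclic a (.head ⟨hab, h₁⟩ (.head ⟨hbc, h₂⟩ (.single ⟨hca, h₃⟩)))

/-- The graph-theoretic content of a super-covered edge: parents of `i` are closed under taking
parents, and so are the vertices not adjacent to `i`. -/
structure IsClosedCover (G : Digraph V) (i j : V) : Prop where
  edge : G.Adj i j
  children_eq : children G i = children G j ∪ {j}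
  parents_eq : parents G i ∪ {i} = parents G j
  parents_children : ∀ k ∈ parents G j, ∀ l ∈ children G i, G.Adj k l
  parents_closed : ∀ p ∈ parents G i, ∀ k, k ≠ p → G.Adj k p → k ∈ parents G i
  rest_closed : ∀ k, k ≠ i → k ≠ j → k ∉ neighbors G i → ∀ x, G.Adj x k →
    x ≠ i ∧ x ≠ j ∧ x ∉ neighbors G i

lemma mem_parents_of_eq (h : parents G i ∪ {i} = parents G j) {k : V} :
    (k ≠ j ∧ G.Adj k j) ↔ ((k ≠ i ∧ G.Adj k i) ∨ k = i) := by
  have := Set.ext_iff.1 h k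
  simpa [parents, or_comm] using this.symm

lemma mem_children_of_eq (h : children G i = children G j ∪ {j}) {k : V} :
    (k ≠ i ∧ G.Adj i k) ↔ ((k ≠ j ∧ G.Adj j k) ∨ k = j) := by
  have := Set.ext_iff.1 h k
  simpa [children, or_comm] using this

lemma ne_of_parents_eq (h : parents G i ∪ {i} = parents G j) : i ≠ j :=
  ((mem_parents_of_eq h).2 (Or.inr rfl)).1

lemma mem_neighbors {k v : V} :
    k ∈ neighbors G v ↔ k ≠ v ∧ (G.Adj k v ∨ G.Adj v k) := by
  simp only [neighbors, parents, children, Set.mem_union, Set.mem_ofPred_eq]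
  tauto

lemma MarginallyIndep.cov_eq_zero {k : V} (h : MarginallyIndep G k i j) {S : Matrix V V ℝ}
    (hS : S ∈ gclm G) : S i k = 0 :=
  ((indepFun_multivariateGaussian_iff hS.1 k i j).1 (h S hS)).1

/-- A violation of either closure property produces a chain or fork joining `i` to a vertex not
adjacent to it, and such a path carries nonzero covariance for some member of the model. -/
lemma IsSuperCovered.isClosedCover (hG : IsSimpleDAG G) (h : IsSuperCovered G i j) :
    IsClosedCover G i j := by
  have hp := fun k => mem_parents_of_eq (k := k) h.parents_eq
  have hc := fun k => mem_children_of_eq (k := k) h.children_eq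
  have hij := ne_of_parents_eq h.parents_eq
  have hind : ∀ k, k ≠ i → k ≠ j → k ∉ neighbors G i → ∀ S ∈ gclm G, S i k = 0 := by
    intro k hki hkj hk S hS
    rcases h.others k hki hkj with h' | h'
    · exact absurd h'.1 hk
    · exact h'.cov_eq_zero hS
  refine ⟨h.edge, h.children_eq, h.parents_eq, h.parents_children, ?_, ?_⟩
  · rintro p ⟨hpi, hadj⟩ k hkp hk
    by_contra hcon
    have hki : k ≠ i := by
      rintro rfl; exact hG.simple k p hkp ⟨hk, hadj⟩
    have hpj := (hp p).2 (Or.inl ⟨hpi, hadj⟩)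
    have hkj : k ≠ j := by
      rintro rfl; exact hG.simple k p hkp ⟨hk, hpj.2⟩
    have hnb : k ∉ neighbors G i := by
      rw [mem_neighbors]
      rintro ⟨_, h1 | h1⟩
      · exact hcon ⟨hki, h1⟩
      · exact hG.no_triangle hki.symm hkp hpi h1 hk hadj
    obtain ⟨S, hS, hne⟩ := exists_cov_ne_zero_of_chain hG hkp hki hpi hk hadj
    rw [posDef_comm hS.1] at hne
    exact hne (hind k hki hkj hnb S hS)
  · intro k hki hkj hk x hx
    rcases eq_or_ne x k with rfl | hxk
    · exact ⟨hki, hkj, hk⟩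
    have hxi : x ≠ i := by
      rintro rfl; exact hk (mem_neighbors.2 ⟨hki, Or.inr hx⟩)
    have hxj : x ≠ j := by
      rintro rfl
      exact hk (mem_neighbors.2 ⟨hki, Or.inr ((hc k).2 (Or.inl ⟨hkj, hx⟩)).2⟩)
    refine ⟨hxi, hxj, fun hxn => ?_⟩
    rcases (mem_neighbors.1 hxn).2 with h1 | h1
    · obtain ⟨S, hS, hne⟩ := exists_cov_ne_zero_of_fork hG hxi.symm hki.symm hxk h1 hx
      exact hne (hind k hki hkj hk S hS)
    · obtain ⟨S, hS, hne⟩ := exists_cov_ne_zero_of_chain hG hxi.symm hki.symm hxk h1 hx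
      exact hne (hind k hki hkj hk S hS)

/-- The parents of `i` together with `i`, `j` form a parent-closed set, and so do the vertices
outside `i`, `j` and the neighbors of `i`. -/
lemma IsClosedCover.cov_eq_zero (hG : IsSimpleDAG G) (h : IsClosedCover G i j)
    {S : Matrix V V ℝ} (hS : S ∈ gclm G) {q r : V} (hq : q ∈ parents G i ∨ q = i ∨ q = j)
    (hri : r ≠ i) (hrj : r ≠ j) (hr : r ∉ neighbors G i) : S q r = 0 := by
  have hp := fun k => mem_parents_of_eq (k := k) h.parents_eq
  refine cov_eq_zero_of_parentClosed hG hS (Q := {q | q ∈ parents G i ∨ q = i ∨ q = j})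
    (R := {r | r ≠ i ∧ r ≠ j ∧ r ∉ neighbors G i}) ?_ ?_ ?_ hq ⟨hri, hrj, hr⟩
  · rintro a b (hb | rfl | rfl) hab
    · rcases eq_or_ne a b with rfl | hne
      · exact Or.inl hb
      · exact Or.inl (h.parents_closed b hb a hne hab)
    · rcases eq_or_ne a b with rfl | hne
      · exact Or.inr (Or.inl rfl)
      · exact Or.inl ⟨hne, hab⟩
    · rcases eq_or_ne a b with rfl | hne
      · exact Or.inr (Or.inr rfl)
      · rcases (hp a).1 ⟨hne, hab⟩ with h1 | h1
        · exact Or.inl h1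
        · exact Or.inr (Or.inl h1)
  · rintro a b ⟨h1, h2, h3⟩ hab
    exact h.rest_closed b h1 h2 h3 a hab
  · rw [Set.disjoint_left]
    rintro a (ha | rfl | rfl) ⟨h1, h2, h3⟩
    · exact h3 (Or.inl ha)
    · exact h1 rfl
    · exact h2 rfl

lemma IsClosedCover.isSuperCovered (hG : IsSimpleDAG G) (h : IsClosedCover G i j) :
    IsSuperCovered G i j := by
  have hp := fun k => mem_parents_of_eq (k := k) h.parents_eq
  have hc := fun k => mem_children_of_eq (k := k) h.children_eq
  refine ⟨h.edge, h.children_eq, h.parents_eq, h.parents_children, fun k hki hkj => ?_⟩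
  by_cases hk : k ∈ neighbors G i
  · refine Or.inl ⟨hk, ?_⟩
    rcases (mem_neighbors.1 hk).2 with h1 | h1
    · exact mem_neighbors.2 ⟨hkj, Or.inl ((hp k).2 (Or.inl ⟨hki, h1⟩)).2⟩
    · exact mem_neighbors.2 ⟨hkj, Or.inr (((hc k).1 ⟨hki, h1⟩).resolve_right hkj).2⟩
  · refine Or.inr fun S hS => (indepFun_multivariateGaussian_iff hS.1 k i j).2 ?_
    exact ⟨h.cov_eq_zero hG hS (Or.inr (Or.inl rfl)) hki hkj hk,
      h.cov_eq_zero hG hS (Or.inr (Or.inr rfl)) hki hkj hk⟩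

lemma flipEdge_adj {a b : V} :
    (flipEdge G i j).Adj a b ↔ (a = j ∧ b = i) ∨ (G.Adj a b ∧ ¬ (a = i ∧ b = j)) := Iff.rfl

lemma IsClosedCover.gclm_subset_flipEdge (hG : IsSimpleDAG G) (h : IsClosedCover G i j) :
    gclm G ⊆ gclm (flipEdge G i j) := by
  intro S hS
  have hp := fun k => mem_parents_of_eq (k := k) h.parents_eq
  have hc := fun k => mem_children_of_eq (k := k) h.children_eq
  have hij := ne_of_parents_eq h.parents_eq
  refine mem_gclm_of_reverse (P := parents G i) (C := children G j) hij (fun h' => h'.1 rfl)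
    (fun h' => hG.simple i j hij ⟨h.edge, h'.2⟩) (fun a b hab hne => Or.inr ⟨hab, hne⟩) ?_ hS ?_
  · intro a b ha hb hne
    by_cases hab : a = j ∧ b = i
    · exact Or.inl hab
    refine Or.inr ⟨?_, hne⟩
    rcases eq_or_ne a b with rfl | hab'
    · exact hG.loops a
    rcases ha with ha | rfl | rfl <;> rcases hb with hb | rfl | rfl
    · exact h.parents_children a ((hp a).2 (Or.inl ha)) b ((hc b).2 (Or.inl hb))
    · exact ha.2
    · exact ((hp a).2 (Or.inl ha)).2
    · exact ((hc b).2 (Or.inl hb)).2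
    · exact hG.loops _
    · exact h.edge
    · exact hb.2
    · exact absurd ⟨rfl, rfl⟩ hab
    · exact hG.loops _
  · intro q r hq hrP hrC hri hrj
    refine h.cov_eq_zero hG hS hq hri hrj ?_
    rintro (h' | h')
    · exact hrP h'
    · exact hrC (((hc r).1 h').resolve_right hrj)

lemma IsClosedCover.isSimpleDAG_flipEdge (hG : IsSimpleDAG G) (h : IsClosedCover G i j) :
    IsSimpleDAG (flipEdge G i j) := by
  have hp := fun k => mem_parents_of_eq (k := k) h.parents_eq
  have hij := ne_of_parents_eq h.parents_eq
  refine ⟨fun a => Or.inr ⟨hG.loops a, ?_⟩, ?_, ?_⟩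
  · rintro ⟨rfl, h'⟩; exact hij h'
  · rintro a b hab ⟨⟨rfl, rfl⟩ | ⟨h1, h2⟩, ⟨rfl, h4⟩ | ⟨h3, h4⟩⟩
    · exact hij h4
    · exact h4 ⟨rfl, rfl⟩
    · exact h2 ⟨h4, rfl⟩
    · exact hG.simple a b hab ⟨h1, h3⟩
  · set r : V → V → Prop := fun a b => a ≠ b ∧ G.Adj a b ∧ ¬ (a = i ∧ b = j) with hr
    -- A walk either avoids the new edge `j → i`, or its part before the first use and its part
    -- after the last use avoid it. A cycle through it gives a walk from `i` to `j` whose last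
    -- vertex before `j` is a parent of `i`, hence a cycle in `G`.
    have key : ∀ a b, Relation.TransGen (fun a b => a ≠ b ∧ (flipEdge G i j).Adj a b) a b →
        Relation.TransGen r a b ∨ (Relation.ReflTransGen r a j ∧ Relation.ReflTransGen r i b) := by
      intro a b hab
      induction hab with
      | single hs =>
        rcases hs.2 with ⟨rfl, rfl⟩ | h'
        · exact Or.inr ⟨.refl, .refl⟩
        · exact Or.inl (.single ⟨hs.1, h'⟩)
      | tail _ hs ih =>
        rcases hs.2 with ⟨rfl, rfl⟩ | h'
        · refine Or.inr ⟨?_, .refl⟩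
          rcases ih with ih | ih
          · exact ih.to_reflTransGen
          · exact ih.1
        · rcases ih with ih | ih
          · exact Or.inl (ih.tail ⟨hs.1, h'⟩)
          · exact Or.inr ⟨ih.1, ih.2.tail ⟨hs.1, h'⟩⟩
    have hmono : ∀ a b, r a b → StrictAdj G a b := fun a b hab => ⟨hab.1, hab.2.1⟩
    intro a ha
    rcases key a a ha with ha | ⟨ha, hb⟩
    · exact hG.acyclic a (Relation.TransGen.mono hmono _ _ ha)
    · rcases Relation.ReflTransGen.cases_tail (hb.trans ha) with h' | ⟨p, hip, hpj⟩
      · exact hij h'.symm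
      · have hpi : p ≠ i := fun h' => hpj.2.2 ⟨h', rfl⟩
        have := ((hp p).1 ⟨hpj.1, hpj.2.1⟩).resolve_right hpi
        exact hG.acyclic i (Relation.TransGen.tail' (Relation.ReflTransGen.mono hmono _ _ hip) this)

lemma flipEdge_flipEdge (hG : IsSimpleDAG G) (hij : i ≠ j) (h : G.Adj i j) :
    flipEdge (flipEdge G i j) j i = G := by
  have := hG.simple i j hij
  ext a b
  simp only [flipEdge_adj]
  grind

lemma IsClosedCover.flipEdge (hG : IsSimpleDAG G) (h : IsClosedCover G i j) :
    IsClosedCover (flipEdge G i j) j i := by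
  have hp := fun k => mem_parents_of_eq (k := k) h.parents_eq
  have hc := fun k => mem_children_of_eq (k := k) h.children_eq
  have hij := ne_of_parents_eq h.parents_eq
  have hji : ¬ G.Adj j i := fun h' => hG.simple i j hij ⟨h.edge, h'⟩
  have hpj : ∀ k, k ∈ parents (LyapunovModel.flipEdge G i j) j ↔ k ∈ parents G i := by
    intro k
    have := hp k
    simp only [parents, Set.mem_ofPred_eq, flipEdge_adj]
    grind
  have hnj : ∀ k, k ≠ i → k ≠ j →
      (k ∈ neighbors (LyapunovModel.flipEdge G i j) j ↔ k ∈ neighbors G i) := by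
    intro k hki hkj
    have := hp k
    have := hc k
    simp only [mem_neighbors, flipEdge_adj]
    grind
  refine ⟨Or.inl ⟨rfl, rfl⟩, ?_, ?_, ?_, ?_, ?_⟩
  · ext k
    have := hc k
    simp only [children, Set.mem_ofPred_eq, flipEdge_adj, Set.mem_union, Set.mem_singleton_iff]
    grind
  · ext k
    have := hp k
    simp only [parents, Set.mem_ofPred_eq, flipEdge_adj, Set.mem_union, Set.mem_singleton_iff]
    grind
  · rintro k hk l hl
    have h1 := hp k
    have h2 := hc l
    have h3 := h.parents_children k
    have h4 := fun h' => h3 h' l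
    simp only [parents, children, Set.mem_ofPred_eq, flipEdge_adj] at hk hl h4 ⊢
    grind
  · intro p hpp k hkp hk
    rw [hpj] at hpp ⊢
    refine h.parents_closed p hpp k hkp ?_
    rcases hk with ⟨_, rfl⟩ | hk
    · exact absurd rfl hpp.1
    · exact hk.1
  · intro k hkj hki hk x hx
    have hx' : G.Adj x k := by
      rcases hx with ⟨_, rfl⟩ | hx
      · exact absurd rfl hki
      · exact hx.1
    obtain ⟨h1, h2, h3⟩ := h.rest_closed k hki hkj (fun h' => hk ((hnj k hki hkj).2 h')) x hx'
    exact ⟨h2, h1, fun h' => h3 ((hnj x h1 h2).1 h')⟩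

lemma IsClosedCover.gclm_flipEdge (hG : IsSimpleDAG G) (h : IsClosedCover G i j) :
    gclm (LyapunovModel.flipEdge G i j) = gclm G := by
  refine Set.Subset.antisymm ?_ (h.gclm_subset_flipEdge hG)
  have := (h.flipEdge hG).gclm_subset_flipEdge (h.isSimpleDAG_flipEdge hG)
  rwa [flipEdge_flipEdge hG (ne_of_parents_eq h.parents_eq) h.edge] at this

lemma SuperCoveredFlip.gclm_eq (h : SuperCoveredFlip G H) : gclm G = gclm H := by
  obtain ⟨hG, i, j, hij, rfl⟩ := h
  exact ((hij.isClosedCover hG).gclm_flipEdge hG).symm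

lemma FlipSequence.gclm_eq {n : ℕ} (h : FlipSequence n G H) : gclm G = gclm H := by
  obtain ⟨f, rfl, rfl, hf⟩ := h
  have : ∀ t ≤ n, gclm (f 0) = gclm (f t) := by
    intro t ht
    induction t with
    | zero => rfl
    | succ t ih => exact (ih (by omega)).trans (hf t ht).gclm_eq
  exact this n le_rfl

lemma FlipSequence.cons {n : ℕ} {K : Digraph V} (h : SuperCoveredFlip G H)
    (h' : FlipSequence n H K) : FlipSequence (n + 1) G K := by
  obtain ⟨f, hf0, hfn, hf⟩ := h'
  refine ⟨fun t => Nat.casesOn t G f, rfl, hfn, fun t ht => ?_⟩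
  cases t with
  | zero => simpa [hf0] using h
  | succ t => exact hf t (by omega)

end Flips

/-! ### Locating a flippable edge and counting flips -/

section Equivalence

variable {V : Type*} [Fintype V] [DecidableEq V] {G H : Digraph V}

lemma sameSkeleton_of_gclm_eq (hG : IsSimpleDAG G) (hH : IsSimpleDAG H)
    (hGH : gclm G = gclm H) : SameSkeleton G H := by
  intro i j
  rcases eq_or_ne i j with rfl | hij
  · simp [hG.loops, hH.loops]
  · constructor
    · rintro (h | h)
      · exact adj_or_adj_of_gclm_subset hG hGH.le hij h
      · exact (adj_or_adj_of_gclm_subset hG hGH.le hij.symm h).symm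
    · rintro (h | h)
      · exact adj_or_adj_of_gclm_subset hH hGH.ge hij h
      · exact (adj_or_adj_of_gclm_subset hH hGH.ge hij.symm h).symm

lemma IsSimpleDAG.wellFounded_swap (hG : IsSimpleDAG G) :
    WellFounded (Function.swap (Relation.TransGen (StrictAdj G))) := by
  have : IsTrans V (Function.swap (Relation.TransGen (StrictAdj G))) :=
    ⟨fun _ _ _ h h' => Relation.TransGen.trans h' h⟩
  have : Std.Irrefl (Function.swap (Relation.TransGen (StrictAdj G))) := ⟨hG.acyclic⟩
  exact Finite.wellFounded_of_trans_of_irrefl _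

/-- Reversed edges contain a closed cover: take the first head `j` of a reversed edge and the
last tail `i` of a reversed edge into `j`. -/
lemma exists_isClosedCover_of_gclm_eq (hG : IsSimpleDAG G) (hH : IsSimpleDAG H)
    (hGH : gclm G = gclm H) (hne : ∃ a b, G.Adj a b ∧ ¬ H.Adj a b) :
    ∃ i j, IsClosedCover G i j ∧ ¬ H.Adj i j := by
  have hsk := sameSkeleton_of_gclm_eq hG hH hGH
  obtain ⟨j, ⟨a, hja⟩, hjmin⟩ := hG.wellFounded.has_min {b | ∃ a, G.Adj a b ∧ ¬ H.Adj a b} (by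
    obtain ⟨a, b, hab⟩ := hne; exact ⟨b, a, hab⟩)
  obtain ⟨i, ⟨hij, hij'⟩, himax⟩ := hG.wellFounded_swap.has_min
    {a | G.Adj a j ∧ ¬ H.Adj a j} ⟨a, hja⟩
  have hne : i ≠ j := by rintro rfl; exact hij' (hH.loops i)
  have hji : H.Adj j i := ((hsk i j).1 (Or.inl hij)).resolve_left hij'
  have hmin : ∀ k x, G.Adj k x → x ≠ j → G.Adj x j → H.Adj k x := by
    intro k x hkx hxj hx
    by_contra hc
    exact hjmin x ⟨k, hkx, hc⟩ (.single ⟨hxj, hx⟩)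
  have hmax : ∀ x, G.Adj x j → x ≠ i → G.Adj i x → H.Adj x j := by
    intro x hxj hxi hix
    by_contra hc
    exact himax x ⟨hxj, hc⟩ (.single ⟨hxi.symm, hix⟩)
  have hnadj : ∀ {a b}, ¬ G.Adj a b → ¬ G.Adj b a → ¬ H.Adj a b := by
    intro a b h1 h2 h3
    exact ((hsk a b).2 (Or.inl h3)).elim h1 h2
  have hin : ∀ {a b c}, a ≠ b → a ≠ c → b ≠ c → G.Adj a b → (G.Adj b c ∨ G.Adj c b) →
      ¬ G.Adj a c → ¬ G.Adj c a → H.Adj a b := adj_of_unshielded hG hH hGH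
  -- Edges leaving the middle vertex are preserved too: otherwise the opposite orientation in `H`
  -- would transfer back to `G`.
  have hout : ∀ {a b c}, a ≠ b → a ≠ c → b ≠ c → G.Adj b a → (G.Adj b c ∨ G.Adj c b) →
      ¬ G.Adj a c → ¬ G.Adj c a → H.Adj b a := by
    intro a b c hab hac hbc h1 h2 h3 h4
    by_contra hc
    have hab' : H.Adj a b := ((hsk a b).1 (Or.inr h1)).resolve_right hc
    have := adj_of_unshielded hH hG hGH.symm hab hac hbc hab' ((hsk b c).1 h2) (hnadj h3 h4)
      (hnadj h4 h3)
    exact hG.simple a b hab ⟨this, h1⟩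
  -- A vertex adjacent to only one endpoint would make `i → j` part of an unshielded path and so fix
  -- its orientation.
  have hadj : ∀ k, k ≠ i → k ≠ j → ((G.Adj k i ∨ G.Adj i k) ↔ (G.Adj k j ∨ G.Adj j k)) := by
    intro k hki hkj
    constructor <;> intro hk <;> by_contra hc <;> push Not at hc
    · exact hij' (hout hne.symm hkj.symm hki.symm hij hk.symm hc.2 hc.1)
    · exact hij' (hin hne hki.symm hkj.symm hij hk.symm hc.2 hc.1)
  have hpar : ∀ k, k ≠ i → k ≠ j → (G.Adj k i ↔ G.Adj k j) := by
    intro k hki hkj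
    constructor
    · intro hk
      refine ((hadj k hki hkj).1 (Or.inl hk)).resolve_right fun h => ?_
      exact hG.no_triangle hne hkj.symm hki hij h hk
    · intro hk
      refine ((hadj k hki hkj).2 (Or.inl hk)).resolve_right fun h => ?_
      -- Only here does the extremal choice of `j` and `i` enter: if `i → k → j` in `G`, both edges
      -- persist in `H` and close a cycle with `j → i`.
      exact hH.no_triangle hki.symm hkj hne.symm (hmin i k h hkj hk) (hmax k hk hki h) hji
  have hch : ∀ k, k ≠ i → k ≠ j → (G.Adj i k ↔ G.Adj j k) := by
    intro k hki hkj
    constructor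
    · intro hk
      refine ((hadj k hki hkj).1 (Or.inr hk)).resolve_left fun h => ?_
      exact hG.simple i k hki.symm ⟨hk, (hpar k hki hkj).2 h⟩
    · intro hk
      refine ((hadj k hki hkj).2 (Or.inr hk)).resolve_left fun h => ?_
      exact hG.simple j k hkj.symm ⟨hk, (hpar k hki hkj).1 h⟩
  have hji' : ¬ G.Adj j i := fun h => hG.simple i j hne ⟨hij, h⟩
  have hrest : ∀ k, k ≠ i → k ≠ j → k ∉ neighbors G i →
      ¬ G.Adj k i ∧ ¬ G.Adj i k ∧ ¬ G.Adj k j ∧ ¬ G.Adj j k := by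
    intro k hki hkj hk
    rw [mem_neighbors] at hk
    have := hadj k hki hkj
    tauto
  refine ⟨i, j, ⟨hij, ?_, ?_, ?_, ?_, ?_⟩, hij'⟩
  · ext k
    have := hch k
    simp only [children, Set.mem_ofPred_eq, Set.mem_union, Set.mem_singleton_iff]
    grind
  · ext k
    have := hpar k
    simp only [parents, Set.mem_ofPred_eq, Set.mem_union, Set.mem_singleton_iff]
    grind
  · rintro k ⟨hkj, hk⟩ l ⟨hli, hl⟩
    rcases eq_or_ne k i with rfl | hki
    · exact hl
    rcases eq_or_ne l j with rfl | hlj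
    · exact hk
    have hk' := (hpar k hki hkj).2 hk
    have hl' := (hch l hli hlj).1 hl
    by_contra hc
    have hkl : k ≠ l := by rintro rfl; exact hc (hG.loops k)
    have hc' : ¬ G.Adj l k := fun h => hG.no_triangle hli.symm hkl.symm hki hl h hk'
    exact false_of_diamond hG hGH.le hH (injective_vec_four hki hkj hkl hne hli.symm hlj.symm)
      hk hl hij (hin hki hkl hli.symm hk' (Or.inl hl) hc hc')
      (hin hkj hkl hlj.symm hk (Or.inl hl') hc hc')
      (hout hli hkl.symm hki.symm hl (Or.inr hk') hc' hc)
      (hout hlj hkl.symm hkj.symm hl' (Or.inr hk) hc' hc) hji (hnadj hc hc') (hnadj hc' hc)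
  · rintro p ⟨hpi, hp⟩ k hkp hk
    have hpj : p ≠ j := by rintro rfl; exact hji' hp
    have hp' := (hpar p hpi hpj).1 hp
    have hki : k ≠ i := by rintro rfl; exact hG.simple k p hkp ⟨hk, hp⟩
    have hkj : k ≠ j := by rintro rfl; exact hG.simple k p hkp ⟨hk, hp'⟩
    by_contra hc
    obtain ⟨n1, n2, n3, n4⟩ := hrest k hki hkj (by
      rw [mem_neighbors]
      rintro ⟨_, h | h⟩
      · exact hc ⟨hki, h⟩
      · exact hG.no_triangle hki.symm hkp hpi h hk hp)
    exact false_of_ancestor hG hGH.le hH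
      (injective_vec_four hki hkj hkp hne hpi.symm hpj.symm) hk hp' hij
      (hin hkp hki hpi hk (Or.inl hp) n1 n2) (hout hpi.symm hki.symm hkp.symm hp (Or.inr hk) n2 n1)
      (hout hpj.symm hkj.symm hkp.symm hp' (Or.inr hk) n4 n3) hji
      (hnadj n1 n2) (hnadj n2 n1) (hnadj n3 n4) (hnadj n4 n3)
  · intro k hki hkj hk x hx
    obtain ⟨n1, n2, n3, n4⟩ := hrest k hki hkj hk
    rcases eq_or_ne x k with rfl | hxk
    · exact ⟨hki, hkj, hk⟩
    have hxi : x ≠ i := by rintro rfl; exact n2 hx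
    have hxj : x ≠ j := by rintro rfl; exact n4 hx
    have hf := injective_vec_four hki hkj hxk.symm hne hxi.symm hxj.symm
    refine ⟨hxi, hxj, fun hxn => ?_⟩
    rcases (mem_neighbors.1 hxn).2 with h1 | h1
    · have h2 := (hpar x hxi hxj).1 h1
      exact false_of_sibling hG hGH.le hH hf hx h2 hij
        (hout hxk.symm hki hxi hx (Or.inl h1) n1 n2)
        (hout hxi.symm hki.symm hxk h1 (Or.inl hx) n2 n1)
        (hout hxj.symm hkj.symm hxk h2 (Or.inl hx) n4 n3) hji
        (hnadj n1 n2) (hnadj n2 n1) (hnadj n3 n4) (hnadj n4 n3)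
    · have h2 := (hch x hxi hxj).1 h1
      exact false_of_descendant hG hGH.le hH hf h1 h2 hx hij
        (hin hxi.symm hki.symm hxk h1 (Or.inl hx) n2 n1)
        (hin hxj.symm hkj.symm hxk h2 (Or.inl hx) n4 n3)
        (hout hxk.symm hki hxi hx (Or.inr h1) n1 n2) hji
        (hnadj n1 n2) (hnadj n2 n1) (hnadj n3 n4) (hnadj n4 n3)

lemma edgeSet_flipEdge_diff {i j : V} (h : H.Adj j i) :
    edgeSet (flipEdge G i j) \ edgeSet H = (edgeSet G \ edgeSet H) \ {(i, j)} := by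
  ext ⟨a, b⟩
  simp only [edgeSet, Set.mem_sdiff, Set.mem_ofPred_eq, flipEdge_adj, Set.mem_singleton_iff,
    Prod.mk.injEq]
  grind

lemma flipSequence_of_gclm_eq (hG : IsSimpleDAG G) (hH : IsSimpleDAG H)
    (hGH : gclm G = gclm H) : FlipSequence (edgeSet G \ edgeSet H).ncard G H := by
  generalize hn : (edgeSet G \ edgeSet H).ncard = n
  induction n generalizing G with
  | zero =>
    have hsk := sameSkeleton_of_gclm_eq hG hH hGH
    have hle : ∀ a b, G.Adj a b → H.Adj a b := by
      intro a b hab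
      by_contra hc
      have hmem : (a, b) ∈ edgeSet G \ edgeSet H := ⟨hab, hc⟩
      rw [Set.ncard_eq_zero] at hn
      rw [hn] at hmem
      exact hmem
    have : G = H := by
      ext a b
      refine ⟨hle a b, fun h => ?_⟩
      rcases eq_or_ne a b with rfl | hab
      · exact hG.loops a
      · exact ((hsk a b).2 (Or.inl h)).resolve_right fun h' => hH.simple a b hab ⟨h, hle b a h'⟩
    exact ⟨fun _ => G, rfl, this, fun t ht => absurd ht (Nat.not_lt_zero t)⟩
  | succ n ih =>
    obtain ⟨⟨a, b⟩, hab⟩ := Set.nonempty_of_ncard_ne_zero (s := edgeSet G \ edgeSet H) (by omega)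
    obtain ⟨i, j, hc, hij⟩ := exists_isClosedCover_of_gclm_eq hG hH hGH ⟨a, b, hab⟩
    have hji : H.Adj j i :=
      ((sameSkeleton_of_gclm_eq hG hH hGH i j).1 (Or.inl hc.edge)).resolve_left hij
    refine FlipSequence.cons ⟨hG, i, j, hc.isSuperCovered hG, rfl⟩
      (ih (hc.isSimpleDAG_flipEdge hG) ((hc.gclm_flipEdge hG).trans hGH) ?_)
    -- The new edge `j → i` already lies in `H`, so the difference loses `(i, j)` and gains nothing.
    rw [edgeSet_flipEdge_diff hji,
      Set.ncard_sdiff_singleton_of_mem (a := (i, j)) (And.intro hc.edge hij), hn]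
    rfl

end Equivalence

end LyapunovModel

theorem mainTheorem2 {V : Type*} [Fintype V] [DecidableEq V] (G₁ G₂ : Digraph V)
    (h₁ : LyapunovModel.IsSimpleDAG G₁) (h₂ : LyapunovModel.IsSimpleDAG G₂) :
    (LyapunovModel.gclm G₁ = LyapunovModel.gclm G₂ ↔
      ∃ n : ℕ, LyapunovModel.FlipSequence n G₁ G₂) ∧
    (LyapunovModel.gclm G₁ = LyapunovModel.gclm G₂ →
      LyapunovModel.SameSkeleton G₁ G₂ ∧
      LyapunovModel.FlipSequence
        (LyapunovModel.edgeSet G₁ \ LyapunovModel.edgeSet G₂).ncard G₁ G₂) :=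
  ⟨⟨fun h => ⟨_, LyapunovModel.flipSequence_of_gclm_eq h₁ h₂ h⟩, fun ⟨_, h⟩ => h.gclm_eq⟩,
    fun h => ⟨LyapunovModel.sameSkeleton_of_gclm_eq h₁ h₂ h,
      LyapunovModel.flipSequence_of_gclm_eq h₁ h₂ h⟩⟩
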